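/- Consider the multivariate regression model $Y=XA+E$, where $X$ is a fixed real $m\times p$ matrix, $A$ is a fixed real $p\times n$ matrix, and $E$ is an $m\times n$ random matrix with independent $N(0,\sigma^2)$ entries. For a $p\times n$ matrix $B$ let $r(B)$ be its rank, $J(B)$ the set of indices of its nonzero rows, $\|\cdot\|_F$ the Frobenius norm, and $$\operatorname{pen}(B)=12\,\sigma^2 r(B)\Bigl\{2n+\log(2e)\,|J(B)|+|J(B)|\log\Bigl(\frac{ep}{|J(B)|}\Bigr)\Bigr\},$$ with $\operatorname{pen}(0)=0$. Let $\widehat B$ be a random matrix (the single-stage JRRS estimator) that minimizes $\|Y-XB\|_F^2+\operatorname{pen}(B)$ over all $p\times n$ matrices $B$. Then $\mathbb E\|XA-X\widehat B\|_F^2<\infty$, and for every $p\times n$ matrix $B$ with $r(B)\ge 1$, $$\mathbb E\bigl[\|XA-X\widehat B\|_F^2\bigr]\le 10\,\|XA-XB\|_F^2+8\operatorname{pen}(B)+768\,n\sigma^2e^{-n/2}.$$ In particular, there is a universal numerical constant $C>0$, independent of $m,n,p,\sigma,X,A$, such that, if $r(A)\ge1$, $$\mathbb E\bigl[\|XA-X\widehat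 B\|_F^2\bigr]\le C\,\sigma^2r(A)\Bigl\{n+|J(A)|\log\Bigl(\frac{ep}{|J(A)|}\Bigr)\Bigr\},$$ and, if moreover $|J(A)|\le p/2$ or $|J(A)|\le n$, $$\mathbb E\bigl[\|XA-X\widehat B\|_F^2\bigr]\le C\,\sigma^2r(A)\Bigl\{n+|J(A)|\log\Bigl(\frac{p}{|J(A)|}\Bigr)\Bigr\}.$$ No condition is imposed on the design matrix $X$. -/

import Mathlib

open MeasureTheory ProbabilityTheory
open scoped NNReal

/-- Squared Frobenius norm: the sum of the squared entries. -/
def frobSq {m n : ℕ} (M : Matrix (Fin m) (Fin n) ℝ) : ℝ :=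
  ∑ i, ∑ j, M i j ^ 2

open Classical in
/-- `J(B)`: the set of indices of the nonzero rows of `B`. -/
noncomputable def rowSupport {p n : ℕ} (B : Matrix (Fin p) (Fin n) ℝ) : Finset (Fin p) :=
  Finset.univ.filter fun i => ∃ j, B i j ≠ 0

/-- The penalty `c σ² r(B) {2n + log(2e) |J(B)| + |J(B)| log(e p / |J(B)|)}`.
For `B = 0` it is `0`. -/
noncomputable def pen {p n : ℕ} (c σ : ℝ) (B : Matrix (Fin p) (Fin n) ℝ) : ℝ :=
  c * σ ^ 2 * (B.rank : ℝ) *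
    (2 * (n : ℝ) + Real.log (2 * Real.exp 1) * ((rowSupport B).card : ℝ) +
      ((rowSupport B).card : ℝ) *
        Real.log (Real.exp 1 * (p : ℝ) / ((rowSupport B).card : ℝ)))

/-- `Bhat` minimizes `‖Y - X B‖_F² + pen(B)` over all `p × n` matrices `B`. -/
def IsJRRS {m n p : ℕ} (c σ : ℝ) (X : Matrix (Fin m) (Fin p) ℝ) (Y : Matrix (Fin m) (Fin n) ℝ)
    (Bhat : Matrix (Fin p) (Fin n) ℝ) : Prop :=
  ∀ B : Matrix (Fin p) (Fin n) ℝ,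
    frobSq (Y - X * Bhat) + pen c σ Bhat ≤ frobSq (Y - X * B) + pen c σ B

/-- The entries of the random matrix `E` are independent `N(0, σ²)` variables. -/
structure IsGaussianNoise {Ω : Type*} [MeasurableSpace Ω] {m n : ℕ} (σ : ℝ≥0)
    (E : Ω → Matrix (Fin m) (Fin n) ℝ) (μ : Measure Ω) : Prop where
  law : ∀ i j, HasLaw (fun ω => E ω i j) (gaussianReal 0 (σ ^ 2)) μ
  indep : iIndepFun (fun (ij : Fin m × Fin n) ω => E ω ij.1 ij.2) μ

/-! Comparing the criterion at `Bhat` and at `B` leaves, besides the penalties, the noise term `2⟨E,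
X Bhat - X B⟩`. If its square is at most `Γ ‖X Bhat - X B‖²`, weighted AM-GM
(`norm_sub_sq_le_of_basic_inequality`) gives the risk bound, provided that the two penalties
dominate a multiple of `Γ` up to a remainder of small mean.

To bound `Γ`, fix a row support `J` and the span `V` of the corresponding columns of `X`. A matrix
of rank at most `ρ` with columns in `V` has squared inner product with `E` at most `ρ ‖P_V E‖²_op`
times its squared norm. A net of `17 ^ n` unit-ball vectors reduces the operator norm to projections
of `E` onto subspaces of dimension at most `|J| + 1`; a fixed matrix `K` orthogonal to `V` costs
only the extra dimension (`inner_add_sq_le_of_net`). Each projection has a chi-square exponential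
moment at most `3 ^ (|J| + 1)`.

The random support of `Bhat` is handled by summing over all `J`. The level `10 n + 3
subsetComplexity p |J|` pays for the net, for the dimension and for the number of supports, leaving
an excess of mean `O(e^{-n/2})` (`integral_totalExcess_le`).

The penalty multiplies each rank by the complexity of its own support, so cross terms must be
avoided. Hence two cases in `IsJRRS.frobSq_sub_le`: the column space of whichever matrix has the
larger rank is the one used for `V`. -/

lemma lintegral_exp_mul_stdGaussianReal (a : ℝ) :
    ∫⁻ z, ENNReal.ofReal (Real.exp (a * z)) ∂(gaussianReal 0 1) =
      ENNReal.ofReal (Real.exp (a ^ 2 / 2)) := by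
  rw [← ofReal_integral_eq_lintegral_ofReal (integrable_exp_mul_gaussianReal a)
    (ae_of_all _ fun _ => (Real.exp_pos _).le)]
  have h := congrFun (mgf_fun_id_gaussianReal (μ := 0) (v := 1)) a
  simp only [mgf] at h
  rw [h]
  simp

/-- The mean is `(1 - 2a)^(-1/2)` with `a = 4/9`, a choice that makes it an integer. -/
lemma lintegral_exp_sq_stdGaussianReal :
    ∫⁻ z, ENNReal.ofReal (Real.exp (4 / 9 * z ^ 2)) ∂(gaussianReal 0 1) = 3 := by
  rw [gaussianReal_of_var_ne_zero _ one_ne_zero,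
    lintegral_withDensity_eq_lintegral_mul _ (measurable_gaussianPDF 0 1) (by fun_prop)]
  have h : ∀ z : ℝ, (gaussianPDF 0 1 * fun z => ENNReal.ofReal (Real.exp (4 / 9 * z ^ 2))) z =
      ENNReal.ofReal ((√(2 * Real.pi))⁻¹ * Real.exp (-(1 / 18) * z ^ 2)) := by
    intro z
    simp only [Pi.mul_apply, gaussianPDF, gaussianPDFReal]
    rw [← ENNReal.ofReal_mul (by positivity), mul_assoc, ← Real.exp_add]
    congr 2
    · simp
    · congr 1
      simp
      ring
  simp_rw [h]
  rw [← ofReal_integral_eq_lintegral_ofReal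
    ((integrable_exp_neg_mul_sq (by norm_num : (0 : ℝ) < 1 / 18)).const_mul _)
    (ae_of_all _ fun _ => by positivity), integral_const_mul, integral_gaussian]
  have : √(Real.pi / (1 / 18)) = 3 * √(2 * Real.pi) := by
    rw [show Real.pi / (1 / 18) = 3 ^ 2 * (2 * Real.pi) by ring, Real.sqrt_mul (by norm_num),
      Real.sqrt_sq (by norm_num)]
  rw [this, mul_comm, mul_assoc, mul_inv_cancel₀ (by positivity)]
  simp

/-! ### Exponential moments of projected noise -/

section ChiSquare

variable {Ω : Type*} [MeasurableSpace Ω] {μ : Measure Ω} [SFinite μ]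
  {H : Type*} [NormedAddCommGroup H] [InnerProductSpace ℝ H] [FiniteDimensional ℝ H]
  [MeasurableSpace H] [BorelSpace H] {E : Ω → H} {s : ℝ}

local notation "⟪" x ", " y "⟫" => inner ℝ x y

/-- Chi-square bound for the orthogonal coordinates of a vector with Gaussian-type moment
generating function. -/
lemma lintegral_exp_inner_add_sum_sq_le (hs : 0 < s) (hEm : AEMeasurable E μ)
    (hE : ∀ K : H, ∫⁻ ω, ENNReal.ofReal (Real.exp ⟪E ω, K⟫) ∂μ ≤
      ENNReal.ofReal (Real.exp (s * ‖K‖ ^ 2 / 2)))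
    {ι : Type*} {b : ι → H} (hb : Orthonormal ℝ b) (t : Finset ι) :
    ∀ K : H, (∀ k ∈ t, ⟪K, b k⟫ = 0) →
      ∫⁻ ω, ENNReal.ofReal (Real.exp (⟪E ω, K⟫ + 4 / (9 * s) * ∑ k ∈ t, ⟪E ω, b k⟫ ^ 2)) ∂μ ≤
        3 ^ t.card * ENNReal.ofReal (Real.exp (s * ‖K‖ ^ 2 / 2)) := by
  classical
  induction t using Finset.induction_on with
  | empty => intro K _; simpa using hE K
  | insert k t hk ih =>
    intro K hK
    -- Gaussian linearisation: for standard normal `z`, the mean of `exp (c z x)` is `exp (4 x² / (9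
    -- s))`. The square of a coordinate thus becomes a random linear shift of `K`, and only the
    -- bound on linear exponential moments is needed.
    set c : ℝ := √(8 / (9 * s)) with hc
    have hc2 : c ^ 2 = 8 / (9 * s) := Real.sq_sqrt (by positivity)
    have hmeas : AEMeasurable (Function.uncurry fun (ω : Ω) (z : ℝ) => ENNReal.ofReal (Real.exp
        (⟪E ω, K + (c * z) • b k⟫ + 4 / (9 * s) * ∑ k ∈ t, ⟪E ω, b k⟫ ^ 2)))
        (μ.prod (gaussianReal 0 1)) := by
      have h1 : AEMeasurable (fun x : Ω × ℝ => E x.1) (μ.prod (gaussianReal 0 1)) :=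
        hEm.comp_fst
      have h2 : ∀ v : H, AEMeasurable (fun x : Ω × ℝ => ⟪E x.1, v⟫)
          (μ.prod (gaussianReal 0 1)) := fun v => h1.inner aemeasurable_const
      have h3 : AEMeasurable (fun x : Ω × ℝ => x.2) (μ.prod (gaussianReal 0 1)) :=
        measurable_snd.aemeasurable
      simp only [Function.uncurry_def, inner_add_right, inner_smul_right]
      refine (Real.measurable_exp.comp_aemeasurable ?_).ennreal_ofReal
      refine ((h2 K).add ((h3.const_mul c).mul (h2 (b k)))).add (AEMeasurable.const_mul ?_ _)
      exact Finset.aemeasurable_fun_sum _ fun i _ => (h2 (b i)).pow_const 2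
    have hexp : ∀ ω, ENNReal.ofReal (Real.exp (⟪E ω, K⟫ + 4 / (9 * s) *
        ∑ i ∈ insert k t, ⟪E ω, b i⟫ ^ 2)) =
        ∫⁻ z, ENNReal.ofReal (Real.exp (⟪E ω, K + (c * z) • b k⟫ +
          4 / (9 * s) * ∑ i ∈ t, ⟪E ω, b i⟫ ^ 2)) ∂(gaussianReal 0 1) := by
      intro ω
      have h : ∀ z : ℝ, ENNReal.ofReal (Real.exp (⟪E ω, K + (c * z) • b k⟫ +
          4 / (9 * s) * ∑ i ∈ t, ⟪E ω, b i⟫ ^ 2)) =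
          ENNReal.ofReal (Real.exp (⟪E ω, K⟫ + 4 / (9 * s) * ∑ i ∈ t, ⟪E ω, b i⟫ ^ 2)) *
            ENNReal.ofReal (Real.exp ((c * ⟪E ω, b k⟫) * z)) := by
        intro z
        rw [← ENNReal.ofReal_mul (Real.exp_pos _).le, ← Real.exp_add, inner_add_right,
          inner_smul_right]
        ring_nf
      simp_rw [h]
      rw [lintegral_const_mul _ (by fun_prop), lintegral_exp_mul_stdGaussianReal,
        ← ENNReal.ofReal_mul (Real.exp_pos _).le, ← Real.exp_add, Finset.sum_insert hk, mul_pow,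
        hc2]
      congr 2
      ring
    simp_rw [hexp]
    rw [lintegral_lintegral_swap hmeas]
    have hKk : ⟪K, b k⟫ = 0 := hK k (Finset.mem_insert_self _ _)
    -- The shifted `K` is still orthogonal to the remaining vectors. By Pythagoras the shift
    -- contributes `exp (4 z² / 9)`, of mean `3`.
    calc _ ≤ ∫⁻ z, 3 ^ t.card * ENNReal.ofReal (Real.exp (s * ‖K + (c * z) • b k‖ ^ 2 / 2))
            ∂(gaussianReal 0 1) := by
          refine lintegral_mono fun z => ih _ fun i hi => ?_
          have : k ≠ i := fun h => hk (h ▸ hi)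
          rw [inner_add_left, inner_smul_left, hK i (Finset.mem_insert_of_mem hi),
            hb.inner_eq_zero this]
          simp
      _ = ∫⁻ z, (3 ^ t.card * ENNReal.ofReal (Real.exp (s * ‖K‖ ^ 2 / 2))) *
            ENNReal.ofReal (Real.exp (4 / 9 * z ^ 2)) ∂(gaussianReal 0 1) := by
          refine lintegral_congr fun z => ?_
          rw [mul_assoc, ← ENNReal.ofReal_mul (Real.exp_pos _).le, ← Real.exp_add]
          congr 3
          rw [norm_add_sq_real, inner_smul_right, hKk, norm_smul, hb.norm_eq_one, mul_one,
            Real.norm_eq_abs, sq_abs, mul_pow, hc2]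
          field_simp
          ring
      _ = _ := by
          rw [lintegral_const_mul _ (by fun_prop), lintegral_exp_sq_stdGaussianReal,
            Finset.card_insert_of_notMem hk]
          ring

/-- Chi-square bound for the squared norm of the projection onto a subspace. -/
lemma lintegral_exp_norm_sq_starProjection_le (hs : 0 < s) (hEm : AEMeasurable E μ)
    (hE : ∀ K : H, ∫⁻ ω, ENNReal.ofReal (Real.exp ⟪E ω, K⟫) ∂μ ≤
      ENNReal.ofReal (Real.exp (s * ‖K‖ ^ 2 / 2))) (S : Submodule ℝ H) :
    ∫⁻ ω, ENNReal.ofReal (Real.exp (4 / (9 * s) * ‖S.starProjection (E ω)‖ ^ 2)) ∂μ ≤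
      3 ^ Module.finrank ℝ S := by
  set b := stdOrthonormalBasis ℝ S with hb
  have hbo : Orthonormal ℝ (fun k => (b k : H)) :=
    b.orthonormal.comp_linearIsometry S.subtypeₗᵢ
  have h := lintegral_exp_inner_add_sum_sq_le hs hEm hE hbo Finset.univ 0 (by simp)
  have hn : ∀ x : H, ‖S.starProjection x‖ ^ 2 = ∑ k, ⟪x, (b k : H)⟫ ^ 2 := by
    intro x
    rw [Submodule.starProjection_apply, ← Submodule.coe_norm, ← b.sum_sq_norm_inner_right]
    refine Finset.sum_congr rfl fun k _ => ?_
    rw [Submodule.inner_orthogonalProjectionOnto_eq_of_mem_left, real_inner_comm, Real.norm_eq_abs,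
      sq_abs]
  simpa [hn] using h

end ChiSquare

/-! ### Nets of the unit ball -/

section Net

variable {G : Type*} [NormedAddCommGroup G] [InnerProductSpace ℝ G]

open Metric in
/-- A `1/8`-separated subset of the unit ball has at most `17 ^ dim` elements. -/
lemma card_le_of_separated_unitBall [FiniteDimensional ℝ G] (s : Finset G) (hs : ∀ c ∈ s, ‖c‖ ≤ 1)
    (h : ∀ c ∈ s, ∀ d ∈ s, c ≠ d → 1 / 8 ≤ ‖c - d‖) : s.card ≤ 17 ^ Module.finrank ℝ G := by
  borelize G
  let μ : Measure G := Measure.addHaar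
  -- Disjoint balls of radius `1/16` inside the ball of radius `17/16`: comparing volumes gives the
  -- ratio `17 ^ dim`.
  have D : Set.PairwiseDisjoint (s : Set G) fun c => ball (c : G) (1 / 16) := by
    rintro c hc d hd hcd
    apply ball_disjoint_ball
    rw [dist_eq_norm]
    have := h c hc d hd hcd
    linarith
  have A_subset : ⋃ c ∈ s, ball (c : G) (1 / 16) ⊆ ball (0 : G) (17 / 16) := by
    refine Set.iUnion₂_subset fun x hx => ball_subset_ball' ?_
    rw [dist_zero_right]
    linarith [hs x hx]
  have I : (s.card : ENNReal) * ENNReal.ofReal ((1 / 16) ^ Module.finrank ℝ G) * μ (ball 0 1) ≤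
      ENNReal.ofReal ((17 / 16) ^ Module.finrank ℝ G) * μ (ball 0 1) := by
    calc _ = μ (⋃ c ∈ s, ball (c : G) (1 / 16)) := by
          rw [measure_biUnion_finset D fun c _ => measurableSet_ball]
          simp only [μ.addHaar_ball_of_pos _ (by norm_num : (0 : ℝ) < 1 / 16)]
          simp only [Finset.sum_const, nsmul_eq_mul, mul_assoc]
      _ ≤ μ (ball (0 : G) (17 / 16)) := measure_mono A_subset
      _ = _ := by simp only [μ.addHaar_ball_of_pos _ (by norm_num : (0 : ℝ) < 17 / 16)]
  have J := (ENNReal.mul_le_mul_iff_left (measure_ball_pos μ _ zero_lt_one).ne'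
    measure_ball_lt_top.ne).1 I
  have K : (s.card : ℝ) ≤ (17 : ℝ) ^ Module.finrank ℝ G := by
    have := ENNReal.toReal_le_of_le_ofReal (by positivity) J
    simpa [div_eq_mul_inv, mul_pow] using this
  exact mod_cast K

variable (G) in
-- A separated set of maximal cardinality is a net, since any uncovered point could be added to it.
lemma exists_net_unitBall [FiniteDimensional ℝ G] : ∃ s : Finset G, (∀ c ∈ s, ‖c‖ ≤ 1) ∧
    s.card ≤ 17 ^ Module.finrank ℝ G ∧ ∀ v : G, ‖v‖ ≤ 1 → ∃ u ∈ s, ‖v - u‖ ≤ 1 / 8 := by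
  classical
  let P : Finset G → Prop := fun s =>
    (∀ c ∈ s, ‖c‖ ≤ 1) ∧ ∀ c ∈ s, ∀ d ∈ s, c ≠ d → 1 / 8 ≤ ‖c - d‖
  let A : Set ℕ := {k | ∃ s, P s ∧ s.card = k}
  have hA : BddAbove A := by
    refine ⟨17 ^ Module.finrank ℝ G, ?_⟩
    rintro _ ⟨s, hs, rfl⟩
    exact card_le_of_separated_unitBall s hs.1 hs.2
  obtain ⟨s, hs, hcard⟩ : sSup A ∈ A := Nat.sSup_mem ⟨0, ∅, by simp [P], rfl⟩ hA
  refine ⟨s, hs.1, card_le_of_separated_unitBall s hs.1 hs.2, fun v hv => ?_⟩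
  by_contra! hcon
  have hvs : v ∉ s := fun hmem => by
    have := hcon v hmem
    norm_num at this
  have hP : P (insert v s) := by
    refine ⟨?_, ?_⟩
    · intro c hc
      rcases Finset.mem_insert.1 hc with rfl | hc
      exacts [hv, hs.1 c hc]
    · intro c hc d hd hcd
      rcases Finset.mem_insert.1 hc with rfl | hc' <;> rcases Finset.mem_insert.1 hd with rfl | hd'
      · exact absurd rfl hcd
      · exact (hcon d hd').le
      · rw [norm_sub_rev]
        exact (hcon c hc').le
      · exact hs.2 c hc' d hd' hcd
  have := le_csSup hA ⟨insert v s, hP, rfl⟩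
  rw [Finset.card_insert_of_notMem hvs, hcard] at this
  omega

/-- The operator norm is attained on a net up to a factor `8/7`. -/
lemma exists_net_opNorm_le {F : Type*} [NormedAddCommGroup F] [NormedSpace ℝ F] {s : Finset G}
    (hnet : ∀ v : G, ‖v‖ ≤ 1 → ∃ u ∈ s, ‖v - u‖ ≤ 1 / 8) (L : G →L[ℝ] F) :
    ∃ u ∈ s, ‖L‖ ≤ 8 / 7 * ‖L u‖ := by
  obtain ⟨u₀, hu₀, -⟩ := hnet 0 (by simp)
  obtain ⟨u, hu, hmax⟩ := s.exists_max_image (fun u => ‖L u‖) ⟨u₀, hu₀⟩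
  refine ⟨u, hu, ?_⟩
  have h : ‖L‖ ≤ ‖L u‖ + ‖L‖ * (1 / 8) := by
    refine L.opNorm_le_of_unit_norm (by positivity) fun v hv => ?_
    obtain ⟨w, hw, hvw⟩ := hnet v hv.le
    calc ‖L v‖ = ‖L w + L (v - w)‖ := by rw [← map_add]; congr 2; abel
      _ ≤ ‖L w‖ + ‖L (v - w)‖ := norm_add_le _ _
      _ ≤ _ := add_le_add (hmax w hw) ((L.le_opNorm _).trans (by gcongr))
  linarith

end Net

/-! ### Deterministic bounds for inner products with low-rank matrices -/

section Columns

variable {F : Type*} [NormedAddCommGroup F] [InnerProductSpace ℝ F] {n : ℕ}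

local notation "⟪" x ", " y "⟫" => inner ℝ x y

/-- Matrices seen as families of columns, with the Frobenius inner product. -/
abbrev ColumnSpace (F : Type*) [NormedAddCommGroup F] [InnerProductSpace ℝ F] (n : ℕ) : Type _ :=
  PiLp 2 (fun _ : Fin n => F)

/-- The map `v ↦ ∑ k, v k • E k` given by a family of columns. -/
noncomputable def columnMap (E : ColumnSpace F n) : EuclideanSpace ℝ (Fin n) →ₗ[ℝ] F where
  toFun v := ∑ k, v k • E k
  map_add' v w := by simp [add_smul, Finset.sum_add_distrib]
  map_smul' c v := by simp [mul_smul, Finset.smul_sum]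

/-- The map `h ↦ h uᵀ`. -/
noncomputable def rankOneMap (u : EuclideanSpace ℝ (Fin n)) : F →ₗ[ℝ] ColumnSpace F n where
  toFun h := WithLp.toLp 2 fun k => u k • h
  map_add' v w := by ext; simp
  map_smul' c v := by ext k; simp [smul_comm c]

lemma inner_rankOneMap (u : EuclideanSpace ℝ (Fin n)) (E : ColumnSpace F n) (h : F) :
    ⟪E, rankOneMap u h⟫ = ⟪columnMap E u, h⟫ := by
  simp [rankOneMap, columnMap, PiLp.inner_apply, sum_inner, inner_smul_left, inner_smul_right]

lemma norm_sq_rankOneMap (u : EuclideanSpace ℝ (Fin n)) (h : F) :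
    ‖rankOneMap u h‖ ^ 2 = ‖u‖ ^ 2 * ‖h‖ ^ 2 := by
  simp [rankOneMap, PiLp.norm_sq_eq_of_L2, norm_smul, mul_pow, Finset.sum_mul]

variable [FiniteDimensional ℝ F]

/-- The span of the matrices `h uᵀ` with `h ∈ V` and of `K`. -/
noncomputable def testSubspace (V : Submodule ℝ F) (K : ColumnSpace F n)
    (u : EuclideanSpace ℝ (Fin n)) : Submodule ℝ (ColumnSpace F n) :=
  V.map (rankOneMap u) ⊔ Submodule.span ℝ {K}

lemma finrank_testSubspace_le (V : Submodule ℝ F) (K : ColumnSpace F n)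
    (u : EuclideanSpace ℝ (Fin n)) :
    Module.finrank ℝ (testSubspace V K u) ≤ Module.finrank ℝ V + 1 := by
  refine (Submodule.finrank_add_le_finrank_add_finrank _ _).trans (add_le_add ?_ ?_)
  · exact Submodule.finrank_map_le _ _
  · exact (finrank_span_le_card ({K} : Set (ColumnSpace F n))).trans (by simp)

/-- Bound for the inner product with a matrix of rank at most `ρ` and columns in `V`. -/
lemma inner_sq_le_of_finrank_le {V : Submodule ℝ F} {E N : ColumnSpace F n} {α : ℝ} {ρ : ℕ}
    (hα : ∀ h ∈ V, ∑ k, ⟪E k, h⟫ ^ 2 ≤ α ^ 2 * ‖h‖ ^ 2) (hN : ∀ k, N k ∈ V)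
    (hρ : Module.finrank ℝ (Submodule.span ℝ (Set.range fun k => N k)) ≤ ρ) :
    ⟪E, N⟫ ^ 2 ≤ ρ * α ^ 2 * ‖N‖ ^ 2 := by
  set U := Submodule.span ℝ (Set.range fun k => N k) with hU
  have hUV : U ≤ V := Submodule.span_le.2 (by rintro _ ⟨k, rfl⟩; exact hN k)
  set b := stdOrthonormalBasis ℝ U
  have hNU : ∀ k, N k ∈ U := fun k => Submodule.subset_span ⟨k, rfl⟩
  -- In an orthonormal basis of the column space of `N`, only the components of `E` along at most
  -- `ρ` basis vectors matter, and each has squared norm at most `α ^ 2`.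
  have h1 : ⟪E, N⟫ = ∑ x : Fin n × Fin (Module.finrank ℝ U),
      ⟪E x.1, (b x.2 : F)⟫ * ⟪(b x.2 : F), N x.1⟫ := by
    rw [PiLp.inner_apply, Fintype.sum_prod_type]
    refine Finset.sum_congr rfl fun k _ => ?_
    have h := b.sum_repr' ⟨N k, hNU k⟩
    have h' : N k = ∑ i, ⟪(b i : F), N k⟫ • (b i : F) := by
      have := congrArg (Submodule.subtype U) h
      simpa using this.symm
    conv_lhs => rw [h', inner_sum]
    refine Finset.sum_congr rfl fun i _ => ?_
    rw [inner_smul_right, mul_comm]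
  have h2 : ∑ x : Fin n × Fin (Module.finrank ℝ U), ⟪E x.1, (b x.2 : F)⟫ ^ 2 ≤ ρ * α ^ 2 := by
    rw [Fintype.sum_prod_type_right]
    calc _ ≤ ∑ _i : Fin (Module.finrank ℝ U), α ^ 2 := by
          refine Finset.sum_le_sum fun i _ => ?_
          have := hα (b i) (hUV (b i).2)
          simpa [← Submodule.coe_norm] using this
      _ ≤ _ := by
          simp only [Finset.sum_const, Finset.card_univ, Fintype.card_fin, nsmul_eq_mul]
          gcongr
  have h3 : ∑ x : Fin n × Fin (Module.finrank ℝ U), ⟪(b x.2 : F), N x.1⟫ ^ 2 = ‖N‖ ^ 2 := by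
    rw [Fintype.sum_prod_type, PiLp.norm_sq_eq_of_L2]
    refine Finset.sum_congr rfl fun k _ => ?_
    have := b.sum_sq_norm_inner_right ⟨N k, hNU k⟩
    simpa using this
  rw [h1, ← h3]
  exact (Finset.sum_mul_sq_le_sq_mul_sq _ _ _).trans (by gcongr)

lemma inner_sq_le_norm_sq_starProjection_mul {H : Type*} [NormedAddCommGroup H]
    [InnerProductSpace ℝ H] (S : Submodule ℝ H) [S.HasOrthogonalProjection] (x : H) {y : H}
    (hy : y ∈ S) : ⟪x, y⟫ ^ 2 ≤ ‖S.starProjection x‖ ^ 2 * ‖y‖ ^ 2 := by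
  have h : ⟪x, y⟫ = ⟪S.starProjection x, y⟫ := by
    conv_lhs => rw [← Submodule.starProjection_eq_self_iff.2 hy]
    rw [Submodule.inner_starProjection_left_eq_right]
  rw [h, ← mul_pow, ← sq_abs]
  gcongr
  exact abs_real_inner_le_norm _ _

/-- Deterministic bound of the inner product of `E` with the sum of a fixed matrix and of a matrix
of rank at most `ρ` with columns in `V`, by projections of `E` onto finitely many subspaces. -/
lemma inner_add_sq_le_of_net {s : Finset (EuclideanSpace ℝ (Fin n))} (hs : ∀ u ∈ s, ‖u‖ ≤ 1)
    (hnet : ∀ v : EuclideanSpace ℝ (Fin n), ‖v‖ ≤ 1 → ∃ u ∈ s, ‖v - u‖ ≤ 1 / 8)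
    {V : Submodule ℝ F} {E K N : ColumnSpace F n} {β : ℝ} {ρ : ℕ}
    (hβ : ∀ u ∈ s, ‖(testSubspace V K u).starProjection E‖ ^ 2 ≤ β)
    (hK : ∀ k, K k ∈ Vᗮ) (hN : ∀ k, N k ∈ V)
    (hρ : Module.finrank ℝ (Submodule.span ℝ (Set.range fun k => N k)) ≤ ρ) (hρ1 : 1 ≤ ρ) :
    ⟪E, N + K⟫ ^ 2 ≤ ρ * (64 / 49 * β) * ‖N + K‖ ^ 2 := by
  -- The net discretises the domain of `P_V E`, so its size depends on `n` alone and not on `V`.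
  set L : EuclideanSpace ℝ (Fin n) →L[ℝ] F :=
    V.starProjection ∘L LinearMap.toContinuousLinearMap (columnMap E) with hL
  have hLapp : ∀ v, L v = V.starProjection (columnMap E v) := fun v => rfl
  obtain ⟨u, hu, hLu⟩ := exists_net_opNorm_le hnet L
  have hβ0 : 0 ≤ β := (sq_nonneg _).trans (hβ u hu)
  set γ : ℝ := ⟪E, K⟫ ^ 2 / ‖K‖ ^ 2 with hγ
  have hγ0 : 0 ≤ γ := by positivity
  have horth : ∀ (v : EuclideanSpace ℝ (Fin n)) (h : F), h ∈ V → ⟪rankOneMap v h, K⟫ = 0 := by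
    intro v h hh
    simp only [rankOneMap, LinearMap.coe_mk, AddHom.coe_mk, PiLp.inner_apply, inner_smul_left]
    exact Finset.sum_eq_zero fun k _ => by rw [hK k h hh, mul_zero]
  have hγK : ⟪E, K⟫ ^ 2 = γ * ‖K‖ ^ 2 := by
    rcases eq_or_ne K 0 with h | h
    · simp [h]
    · rw [hγ, div_mul_cancel₀]
      positivity
  have hLuE : ⟪columnMap E u, L u⟫ = ‖L u‖ ^ 2 := by
    rw [hLapp, ← real_inner_self_eq_norm_sq, Submodule.inner_starProjection_left_eq_right,
      Submodule.starProjection_eq_self_iff.2 (Submodule.starProjection_apply_mem _ _)]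
  have hLuV : L u ∈ V := Submodule.starProjection_apply_mem _ _
  -- Testing `E` against `(L u) uᵀ + t K`, with `t K` the projection of `E` onto the line of `K`,
  -- controls both contributions by one projection.
  have hq : ‖L u‖ ^ 2 + γ ≤ β := by
    set t : ℝ := ⟪E, K⟫ / ‖K‖ ^ 2 with ht
    have hmem : rankOneMap u (L u) + t • K ∈ testSubspace V K u :=
      Submodule.add_mem_sup (Submodule.mem_map_of_mem hLuV)
        (Submodule.smul_mem _ _ (Submodule.mem_span_singleton_self K))
    have h := inner_sq_le_norm_sq_starProjection_mul _ E hmem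
    have h1 : ⟪E, rankOneMap u (L u) + t • K⟫ = ‖L u‖ ^ 2 + γ := by
      rw [inner_add_right, inner_rankOneMap, inner_smul_right, hLuE, ht, hγ]
      ring
    have h2 : ‖rankOneMap u (L u) + t • K‖ ^ 2 ≤ ‖L u‖ ^ 2 + γ := by
      rw [norm_add_sq_real, inner_smul_right, horth u _ hLuV, norm_sq_rankOneMap, norm_smul,
        mul_pow, Real.norm_eq_abs, sq_abs]
      have h3 : t ^ 2 * ‖K‖ ^ 2 = γ := by
        rcases eq_or_ne K 0 with h | h
        · simp [h, hγ]
        · have : ‖K‖ ≠ 0 := by positivity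
          rw [ht, hγ]
          field_simp
      have h4 : ‖u‖ ^ 2 ≤ 1 := pow_le_one₀ (norm_nonneg _) (hs u hu)
      nlinarith [sq_nonneg ‖L u‖]
    rw [h1] at h
    have h5 : (‖L u‖ ^ 2 + γ) ^ 2 ≤ β * (‖L u‖ ^ 2 + γ) :=
      h.trans (mul_le_mul (hβ u hu) h2 (sq_nonneg _) hβ0)
    by_contra! hcon
    nlinarith [mul_pos (hβ0.trans_lt hcon) (sub_pos.2 hcon)]
  have hαγ : ‖L‖ ^ 2 + γ ≤ 64 / 49 * β := by
    have : ‖L‖ ^ 2 ≤ (8 / 7 * ‖L u‖) ^ 2 := by gcongr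
    nlinarith
  -- The left side is the squared norm of the adjoint of `L` at `h`.
  have hα : ∀ h ∈ V, ∑ k, ⟪E k, h⟫ ^ 2 ≤ ‖L‖ ^ 2 * ‖h‖ ^ 2 := by
    intro h hh
    set v : EuclideanSpace ℝ (Fin n) := WithLp.toLp 2 fun k => ⟪E k, h⟫ with hv
    have h1 : ∑ k, ⟪E k, h⟫ ^ 2 = ‖v‖ ^ 2 := by simp [hv, EuclideanSpace.norm_sq_eq]
    have h2 : ‖v‖ ^ 2 = ⟪L v, h⟫ := by
      rw [hLapp, Submodule.inner_starProjection_left_eq_right,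
        Submodule.starProjection_eq_self_iff.2 hh, ← h1]
      simp [columnMap, hv, sum_inner, inner_smul_left, sq]
    have h3 : ‖v‖ ^ 2 ≤ ‖L‖ * ‖v‖ * ‖h‖ := by
      rw [h2]
      exact (real_inner_le_norm _ _).trans (by gcongr; exact L.le_opNorm v)
    have h4 : ‖v‖ ≤ ‖L‖ * ‖h‖ := by
      rcases (norm_nonneg v).eq_or_lt with h | h
      · rw [← h]
        positivity
      · nlinarith
    rw [h1, ← mul_pow]
    gcongr
  have ha := inner_sq_le_of_finrank_le hα hN hρ
  have hNK : ⟪N, K⟫ = 0 := by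
    rw [PiLp.inner_apply]
    exact Finset.sum_eq_zero fun k _ => hK k _ (hN k)
  have hnorm : ‖N + K‖ ^ 2 = ‖N‖ ^ 2 + ‖K‖ ^ 2 := by
    rw [norm_add_sq_real, hNK]
    ring
  have hρ1' : (1 : ℝ) ≤ ρ := by exact_mod_cast hρ1
  have hCS : (⟪E, N⟫ + ⟪E, K⟫) ^ 2 ≤ (ρ * ‖L‖ ^ 2 + γ) * (‖N‖ ^ 2 + ‖K‖ ^ 2) := by
    set x := √(ρ * ‖L‖ ^ 2)
    set y := √γ
    have hx : x ^ 2 = ρ * ‖L‖ ^ 2 := Real.sq_sqrt (by positivity)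
    have hy : y ^ 2 = γ := Real.sq_sqrt hγ0
    have h1 : |⟪E, N⟫| ≤ x * ‖N‖ := abs_le_of_sq_le_sq (by rw [mul_pow, hx]; exact ha)
      (by positivity)
    have h2 : |⟪E, K⟫| ≤ y * ‖K‖ := abs_le_of_sq_le_sq (by rw [mul_pow, hy]; exact hγK.le)
      (by positivity)
    calc (⟪E, N⟫ + ⟪E, K⟫) ^ 2 ≤ (x * ‖N‖ + y * ‖K‖) ^ 2 := by
          rw [← sq_abs]
          gcongr
          exact (abs_add_le _ _).trans (add_le_add h1 h2)
      _ ≤ (x ^ 2 + y ^ 2) * (‖N‖ ^ 2 + ‖K‖ ^ 2) := by nlinarith [sq_nonneg (x * ‖K‖ - y * ‖N‖)]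
      _ = _ := by rw [hx, hy]
  rw [inner_add_right, hnorm]
  refine hCS.trans ?_
  gcongr
  -- Here `1 ≤ ρ` is used, to replace `γ` by `ρ * γ`.
  nlinarith [sq_nonneg ‖L‖]

end Columns

/-! ### Integrable excess of the noise over a level -/

section Excess

local notation "⟪" x ", " y "⟫" => inner ℝ x y

/-- A finite `1/8`-net of the Euclidean unit ball. -/
noncomputable def unitBallNet (n : ℕ) : Finset (EuclideanSpace ℝ (Fin n)) :=
  (exists_net_unitBall (EuclideanSpace ℝ (Fin n))).choose

lemma norm_le_one_of_mem_unitBallNet {n : ℕ} :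
    ∀ u ∈ unitBallNet n, ‖u‖ ≤ 1 :=
  (exists_net_unitBall (EuclideanSpace ℝ (Fin n))).choose_spec.1

lemma card_unitBallNet_le (n : ℕ) : (unitBallNet n).card ≤ 17 ^ n :=
  (exists_net_unitBall (EuclideanSpace ℝ (Fin n))).choose_spec.2.1.trans_eq (by simp)

lemma exists_mem_unitBallNet {n : ℕ} :
    ∀ v : EuclideanSpace ℝ (Fin n), ‖v‖ ≤ 1 → ∃ u ∈ unitBallNet n, ‖v - u‖ ≤ 1 / 8 :=
  (exists_net_unitBall (EuclideanSpace ℝ (Fin n))).choose_spec.2.2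

variable {F : Type*} [NormedAddCommGroup F] [InnerProductSpace ℝ F] [FiniteDimensional ℝ F] {n : ℕ}

/-- Exponential control of the excess over `s * T` of the squared inner products of `E`
with matrices having columns in `V`, up to multiples of `K`. -/
noncomputable def noiseExcess (s T : ℝ) (V : Submodule ℝ F) (K E : ColumnSpace F n) : ℝ :=
  144 / 49 * Real.exp (-(49 / 144 * T)) *
    ∑ u ∈ unitBallNet n, Real.exp (4 / (9 * s) * ‖(testSubspace V K u).starProjection E‖ ^ 2)

lemma noiseExcess_nonneg (s T : ℝ) (V : Submodule ℝ F) (K E : ColumnSpace F n) :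
    0 ≤ noiseExcess s T V K E := by
  unfold noiseExcess
  positivity

/-- The maximum over the net is at most a log-sum-exp, and a tangent line turns the logarithm into a
level plus a term whose mean is computable. The constant `144/49` is `(8/7)² · 9/4`, from the net
and from the exponent `4/9`. -/
lemma inner_add_sq_le_noiseExcess {s : ℝ} (hs : 0 < s) (T : ℝ)
    {V : Submodule ℝ F} {E K N : ColumnSpace F n} {ρ : ℕ}
    (hK : ∀ k, K k ∈ Vᗮ) (hN : ∀ k, N k ∈ V)
    (hρ : Module.finrank ℝ (Submodule.span ℝ (Set.range fun k => N k)) ≤ ρ) (hρ1 : 1 ≤ ρ) :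
    ⟪E, N + K⟫ ^ 2 ≤ ρ * (s * (T + noiseExcess s T V K E)) * ‖N + K‖ ^ 2 := by
  set Q : ℝ := ∑ u ∈ unitBallNet n,
    Real.exp (4 / (9 * s) * ‖(testSubspace V K u).starProjection E‖ ^ 2) with hQ
  obtain ⟨u₀, hu₀, -⟩ := exists_mem_unitBallNet (0 : EuclideanSpace ℝ (Fin n)) (by simp)
  have hQpos : 0 < Q := Finset.sum_pos (fun _ _ => Real.exp_pos _) ⟨u₀, hu₀⟩
  have hβ : ∀ u ∈ unitBallNet n, ‖(testSubspace V K u).starProjection E‖ ^ 2 ≤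
      9 * s / 4 * Real.log Q := by
    intro u hu
    have h1 : Real.exp (4 / (9 * s) * ‖(testSubspace V K u).starProjection E‖ ^ 2) ≤ Q :=
      Finset.single_le_sum (f := fun u => Real.exp (4 / (9 * s) *
        ‖(testSubspace V K u).starProjection E‖ ^ 2)) (fun _ _ => (Real.exp_pos _).le) hu
    have h2 := (Real.le_log_iff_exp_le hQpos).2 h1
    have h3 : 4 / (9 * s) * (9 * s / 4) = 1 := by field_simp
    calc _ = 9 * s / 4 * (4 / (9 * s) * ‖(testSubspace V K u).starProjection E‖ ^ 2) := by
          rw [← mul_assoc, mul_comm (9 * s / 4), h3, one_mul]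
      _ ≤ _ := by gcongr
  -- This is `log x ≤ x - 1` at `x = Q exp (-49T/144)`.
  have h4 : Real.log Q ≤ 49 / 144 * T + Q * Real.exp (-(49 / 144 * T)) := by
    have h5 := Real.log_le_sub_one_of_pos (mul_pos hQpos (Real.exp_pos (-(49 / 144 * T))))
    rw [Real.log_mul hQpos.ne' (Real.exp_pos _).ne', Real.log_exp] at h5
    linarith
  have h6 : 64 / 49 * (9 * s / 4 * Real.log Q) ≤ s * (T + noiseExcess s T V K E) := by
    calc 64 / 49 * (9 * s / 4 * Real.log Q) = s * (144 / 49 * Real.log Q) := by ring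
      _ ≤ s * (144 / 49 * (49 / 144 * T + Q * Real.exp (-(49 / 144 * T)))) := by gcongr
      _ = s * (T + 144 / 49 * Real.exp (-(49 / 144 * T)) * Q) := by ring
  exact (inner_add_sq_le_of_net norm_le_one_of_mem_unitBallNet exists_mem_unitBallNet hβ hK hN hρ
    hρ1).trans (by gcongr)

variable {Ω : Type*} [MeasurableSpace Ω] {μ : Measure Ω} [SFinite μ]
  [MeasurableSpace (ColumnSpace F n)] [BorelSpace (ColumnSpace F n)]

/-- The factor `17 ^ n` counts the net; the `+ 1` in the exponent is the line spanned by `K`. -/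
lemma integrable_noiseExcess {E : Ω → ColumnSpace F n} {s : ℝ} (hs : 0 < s)
    (hEm : AEMeasurable E μ)
    (hE : ∀ K : ColumnSpace F n, ∫⁻ ω, ENNReal.ofReal (Real.exp ⟪E ω, K⟫) ∂μ ≤
      ENNReal.ofReal (Real.exp (s * ‖K‖ ^ 2 / 2))) (T : ℝ) (V : Submodule ℝ F)
    (K : ColumnSpace F n) {d : ℕ} (hd : Module.finrank ℝ V ≤ d) :
    Integrable (fun ω => noiseExcess s T V K (E ω)) μ ∧
      ∫ ω, noiseExcess s T V K (E ω) ∂μ ≤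
        144 / 49 * Real.exp (-(49 / 144 * T)) * (17 ^ n * 3 ^ (d + 1)) := by
  have hone : ∀ S : Submodule ℝ (ColumnSpace F n), Module.finrank ℝ S ≤ d + 1 →
      Integrable (fun ω => Real.exp (4 / (9 * s) * ‖S.starProjection (E ω)‖ ^ 2)) μ ∧
        ∫ ω, Real.exp (4 / (9 * s) * ‖S.starProjection (E ω)‖ ^ 2) ∂μ ≤ 3 ^ (d + 1) := by
    intro S hS
    have h := lintegral_exp_norm_sq_starProjection_le hs hEm hE S
    have hm : AEMeasurable (fun ω => Real.exp (4 / (9 * s) * ‖S.starProjection (E ω)‖ ^ 2)) μ := by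
      fun_prop
    have hlt : ∫⁻ ω, ENNReal.ofReal (Real.exp (4 / (9 * s) * ‖S.starProjection (E ω)‖ ^ 2)) ∂μ ≤
        3 ^ (d + 1) := h.trans (pow_le_pow_right₀ (by norm_num) hS)
    refine ⟨⟨hm.aestronglyMeasurable, ?_⟩, ?_⟩
    · rw [hasFiniteIntegral_iff_ofReal (ae_of_all _ fun _ => (Real.exp_pos _).le)]
      exact hlt.trans_lt (by finiteness)
    · rw [integral_eq_lintegral_of_nonneg_ae (ae_of_all _ fun _ => (Real.exp_pos _).le)
        hm.aestronglyMeasurable]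
      refine (ENNReal.toReal_mono (by finiteness) hlt).trans_eq (by simp)
  have hS : ∀ u ∈ unitBallNet n, Module.finrank ℝ (testSubspace V K u) ≤ d + 1 := fun u _ =>
    (finrank_testSubspace_le V K u).trans (by omega)
  refine ⟨(integrable_finsetSum _ fun u hu => (hone _ (hS u hu)).1).const_mul _, ?_⟩
  unfold noiseExcess
  rw [integral_const_mul, integral_finsetSum _ fun u hu => (hone _ (hS u hu)).1]
  gcongr
  calc _ ≤ ∑ _u ∈ unitBallNet n, (3 : ℝ) ^ (d + 1) :=
        Finset.sum_le_sum fun u hu => (hone _ (hS u hu)).2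
    _ = (unitBallNet n).card * 3 ^ (d + 1) := by simp
    _ ≤ _ := by
      gcongr
      exact_mod_cast card_unitBallNet_le n

end Excess

/-! ### Counting supports against the noise level -/

section Entropy

/-- The complexity `log(2e) j + j log(ep/j)` of the subsets of size `j`. -/
noncomputable def subsetComplexity (p j : ℕ) : ℝ :=
  Real.log (2 * Real.exp 1) * (j : ℝ) + (j : ℝ) * Real.log (Real.exp 1 * (p : ℝ) / (j : ℝ))

lemma le_mul_log_div {p j : ℕ} (h : j ≤ p) :
    (j : ℝ) ≤ j * Real.log (Real.exp 1 * (p : ℝ) / (j : ℝ)) := by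
  rcases Nat.eq_zero_or_pos j with rfl | hj
  · simp
  have hj' : (0 : ℝ) < j := by exact_mod_cast hj
  have h1 : (j : ℝ) ≤ p := by exact_mod_cast h
  have h2 : 1 ≤ Real.log (Real.exp 1 * (p : ℝ) / (j : ℝ)) := by
    rw [Real.le_log_iff_exp_le (by have := hj'.trans_le h1; positivity), le_div_iff₀ hj']
    gcongr
  nlinarith

/-- This is `choose p j ≤ (e p / j) ^ j`, from `choose p j ≤ p ^ j / j!` and `j ^ j / j! ≤ e ^ j`.
-/
lemma choose_mul_exp_neg_le_one (p j : ℕ) :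
    (p.choose j : ℝ) * Real.exp (-(j * Real.log (Real.exp 1 * (p : ℝ) / (j : ℝ)))) ≤ 1 := by
  rcases Nat.eq_zero_or_pos j with rfl | hj
  · simp
  rcases lt_or_ge p j with hpj | hpj
  · simp [Nat.choose_eq_zero_of_lt hpj]
  have hj' : (0 : ℝ) < j := by exact_mod_cast hj
  have hp' : (0 : ℝ) < p := by exact_mod_cast hj.trans_le hpj
  rw [Real.exp_neg, ← Real.log_pow, Real.exp_log (by positivity), ← div_eq_mul_inv,
    div_le_one (by positivity)]
  calc (p.choose j : ℝ) ≤ (p : ℝ) ^ j / j.factorial := Nat.choose_le_pow_div j p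
    _ = (j : ℝ) ^ j / j.factorial * (p / j : ℝ) ^ j := by rw [div_pow]; field_simp
    _ ≤ Real.exp j * (p / j : ℝ) ^ j := by
        gcongr
        exact Real.pow_div_factorial_le_exp _ hj'.le j
    _ = _ := by rw [mul_div_assoc, mul_pow, ← Real.exp_nat_mul, mul_one]

lemma seventeen_le_exp : (17 : ℝ) ≤ Real.exp (29 / 10) := by
  have h : (17 : ℝ) ^ 10 ≤ Real.exp (29 / 10) ^ 10 := by
    rw [← Real.exp_nat_mul, show ((10 : ℕ) : ℝ) * (29 / 10) = ((29 : ℕ) : ℝ) * 1 by norm_num,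
      Real.exp_nat_mul]
    calc (17 : ℝ) ^ 10 ≤ 2.7182818283 ^ 29 := by norm_num
      _ ≤ _ := by
        gcongr
        exact Real.exp_one_gt_d9.le
  exact le_of_pow_le_pow_left₀ (by norm_num) (Real.exp_pos _).le h

/-- The budget: `490/144 ≥ 29/10 + 1/2`, where `29/10` absorbs `17 ^ n` and `1/2` yields `e^{-n/2}`.
Since `147/144 ≥ 1`, the `log (2e)` term turns `3 ^ j` into at most `(3/5) ^ j` and the other
logarithm is kept to pay for the supports. -/
lemma exp_neg_mul_pow_le (n : ℕ) {p j : ℕ} (h : j ≤ p) :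
    Real.exp (-(49 / 144 * (10 * n + 3 * subsetComplexity p j))) * (17 ^ n * 3 ^ (j + 1)) ≤
      3 * Real.exp (-(n : ℝ) / 2) * ((3 / 5) ^ j *
        Real.exp (-(j * Real.log (Real.exp 1 * (p : ℝ) / (j : ℝ))))) := by
  set L : ℝ := j * Real.log (Real.exp 1 * (p : ℝ) / (j : ℝ)) with hL
  have hLj : (j : ℝ) ≤ L := le_mul_log_div h
  have hj0 : (0 : ℝ) ≤ j := j.cast_nonneg
  have he : (5 : ℝ) / 2 ≤ Real.exp 1 := by linarith [Real.exp_one_gt_d9]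
  have hlog : 0 ≤ Real.log (2 * Real.exp 1) := Real.log_nonneg (by linarith)
  have h1 : Real.exp (-(49 / 144 * (10 * n + 3 * subsetComplexity p j))) ≤
      Real.exp (-(n : ℝ) / 2) * Real.exp (-(29 / 10)) ^ n *
        Real.exp (-Real.log (2 * Real.exp 1)) ^ j * Real.exp (-L) := by
    rw [← Real.exp_nat_mul, ← Real.exp_nat_mul, ← Real.exp_add, ← Real.exp_add, ← Real.exp_add,
      Real.exp_le_exp]
    have : subsetComplexity p j = Real.log (2 * Real.exp 1) * j + L := rfl
    rw [this]
    have hn : (0 : ℝ) ≤ n := n.cast_nonneg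
    nlinarith [mul_nonneg hlog hj0]
  have h2 : Real.exp (-(29 / 10)) ^ n * 17 ^ n ≤ 1 := by
    rw [← mul_pow]
    refine pow_le_one₀ (by positivity) ?_
    rw [Real.exp_neg, inv_mul_le_one₀ (Real.exp_pos _)]
    exact seventeen_le_exp
  have h3 : Real.exp (-Real.log (2 * Real.exp 1)) ^ j * 3 ^ j ≤ (3 / 5) ^ j := by
    rw [← mul_pow]
    gcongr
    rw [Real.exp_neg, Real.exp_log (by positivity), inv_mul_le_iff₀ (by positivity)]
    linarith
  calc _ ≤ (Real.exp (-(n : ℝ) / 2) * Real.exp (-(29 / 10)) ^ n *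
        Real.exp (-Real.log (2 * Real.exp 1)) ^ j * Real.exp (-L)) * (17 ^ n * 3 ^ (j + 1)) := by
        gcongr
    _ = 3 * Real.exp (-(n : ℝ) / 2) * (Real.exp (-(29 / 10)) ^ n * 17 ^ n) *
        ((Real.exp (-Real.log (2 * Real.exp 1)) ^ j * 3 ^ j) * Real.exp (-L)) := by ring
    _ ≤ 3 * Real.exp (-(n : ℝ) / 2) * 1 * ((3 / 5) ^ j * Real.exp (-L)) := by gcongr
    _ = _ := by ring

lemma sum_finset_exp_neg_le (p : ℕ) :
    ∑ J : Finset (Fin p), ((3 / 5 : ℝ) ^ J.card *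
      Real.exp (-(J.card * Real.log (Real.exp 1 * (p : ℝ) / (J.card : ℝ))))) ≤ 5 / 2 := by
  rw [← Finset.powerset_univ, Finset.sum_powerset_apply_card
    (fun j : ℕ => ((3 / 5 : ℝ) ^ j *
      Real.exp (-(j * Real.log (Real.exp 1 * (p : ℝ) / (j : ℝ)))))), Finset.card_univ,
    Fintype.card_fin]
  calc _ ≤ ∑ j ∈ Finset.range (p + 1), (3 / 5 : ℝ) ^ j := by
        refine Finset.sum_le_sum fun j _ => ?_
        rw [nsmul_eq_mul, mul_left_comm]
        exact mul_le_of_le_one_right (by positivity) (choose_mul_exp_neg_le_one p j)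
    _ ≤ 5 / 2 := by
        rw [geom_sum_eq (by norm_num)]
        have : (0 : ℝ) ≤ (3 / 5) ^ (p + 1) := by positivity
        rw [div_le_iff_of_neg (by norm_num)]
        linarith

end Entropy

/-! ### Gaussian noise matrices as families of columns -/

section Gaussian

variable {Ω : Type*} [MeasurableSpace Ω] {μ : Measure Ω} {m n : ℕ}

/-- The family of the columns of a matrix. -/
noncomputable def toColumns (M : Matrix (Fin m) (Fin n) ℝ) :
    ColumnSpace (EuclideanSpace ℝ (Fin m)) n :=
  WithLp.toLp 2 fun k => WithLp.toLp 2 fun i => M i k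

lemma toColumns_apply (M : Matrix (Fin m) (Fin n) ℝ) (k : Fin n) (i : Fin m) :
    toColumns M k i = M i k := rfl

lemma norm_sq_toColumns (M : Matrix (Fin m) (Fin n) ℝ) : ‖toColumns M‖ ^ 2 = frobSq M := by
  simp only [PiLp.norm_sq_eq_of_L2, toColumns_apply, Real.norm_eq_abs,
    sq_abs, frobSq]
  exact Finset.sum_comm

lemma toColumns_sub (M N : Matrix (Fin m) (Fin n) ℝ) :
    toColumns (M - N) = toColumns M - toColumns N := by
  ext k i
  simp [toColumns_apply]

lemma aemeasurable_toColumns {E : Ω → Matrix (Fin m) (Fin n) ℝ}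
    (hE : ∀ i j, AEMeasurable (fun ω => E ω i j) μ) : AEMeasurable (fun ω => toColumns (E ω)) μ := by
  refine (WithLp.measurable_toLp 2 _).comp_aemeasurable (aemeasurable_pi_lambda _ fun k => ?_)
  exact (WithLp.measurable_toLp 2 _).comp_aemeasurable (aemeasurable_pi_lambda _ fun i => hE i k)

lemma IsGaussianNoise.lintegral_exp_inner_le {σ : ℝ≥0} {E : Ω → Matrix (Fin m) (Fin n) ℝ}
    (hE : IsGaussianNoise σ E μ) (K : ColumnSpace (EuclideanSpace ℝ (Fin m)) n) :
    ∫⁻ ω, ENNReal.ofReal (Real.exp (inner ℝ (toColumns (E ω)) K)) ∂μ ≤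
      ENNReal.ofReal (Real.exp ((σ : ℝ) ^ 2 * ‖K‖ ^ 2 / 2)) := by
  set Z : Fin m × Fin n → Ω → ℝ := fun ij ω => K ij.2 ij.1 * E ω ij.1 ij.2 with hZ
  have hind : iIndepFun Z μ := hE.indep.comp (fun ij x => K ij.2 ij.1 * x) (fun ij => by fun_prop)
  have hZm : ∀ ij, AEMeasurable (Z ij) μ := fun ij =>
    ((hE.law ij.1 ij.2).aemeasurable).const_mul _
  have hmgf := hind.mgf_sum₀ (t := 1) hZm Finset.univ
  have hsum : ∀ ω, (∑ ij, Z ij) ω = inner ℝ (toColumns (E ω)) K := by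
    intro ω
    simp only [Finset.sum_apply, hZ, PiLp.inner_apply, toColumns_apply, Fintype.sum_prod_type_right]
    simp [mul_comm]
  have hprod : ∏ ij, mgf (Z ij) μ 1 = Real.exp ((σ : ℝ) ^ 2 * ‖K‖ ^ 2 / 2) := by
    have h1 : ∀ ij, mgf (Z ij) μ 1 = Real.exp ((σ : ℝ) ^ 2 * K ij.2 ij.1 ^ 2 / 2) := by
      intro ij
      rw [hZ, mgf_const_mul, mgf_gaussianReal (hE.law ij.1 ij.2).map_eq]
      simp
    simp_rw [h1]
    rw [← Real.exp_sum]
    congr 1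
    simp only [PiLp.norm_sq_eq_of_L2, Fintype.sum_prod_type_right,
      Real.norm_eq_abs, sq_abs, Finset.mul_sum, Finset.sum_div]
  rw [hprod] at hmgf
  simp only [mgf, one_mul, hsum] at hmgf
  -- A non-integrable function has integral `0` by convention, whereas this integral is a positive
  -- exponential.
  have hint : Integrable (fun ω => Real.exp (inner ℝ (toColumns (E ω)) K)) μ := by
    by_contra hcon
    rw [integral_undef hcon] at hmgf
    exact (Real.exp_pos _).ne hmgf
  rw [← ofReal_integral_eq_lintegral_ofReal hint (ae_of_all _ fun _ => (Real.exp_pos _).le), hmgf]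

end Gaussian

lemma finrank_span_map_le {M M' ι : Type*} [AddCommGroup M] [Module ℝ M] [FiniteDimensional ℝ M]
    [AddCommGroup M'] [Module ℝ M'] (L : M →ₗ[ℝ] M') (x : ι → M) :
    Module.finrank ℝ (Submodule.span ℝ (Set.range fun k => L (x k))) ≤
      Module.finrank ℝ (Submodule.span ℝ (Set.range x)) := by
  rw [Set.range_comp' L x, ← Submodule.map_span]
  exact Submodule.finrank_map_le _ _

/-! ### Noise bounds by projection and the basic inequality -/

section Deterministic

local notation "⟪" x ", " y "⟫" => inner ℝ x y

variable {F : Type*} [NormedAddCommGroup F] [InnerProductSpace ℝ F] [FiniteDimensional ℝ F] {n : ℕ}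

lemma inner_sq_le_noiseExcess {s : ℝ} (hs : 0 < s) (T : ℝ) {V : Submodule ℝ F}
    {E N : ColumnSpace F n} {ρ : ℕ} (hN : ∀ k, N k ∈ V)
    (hρ : Module.finrank ℝ (Submodule.span ℝ (Set.range fun k => N k)) ≤ ρ) :
    ⟪E, N⟫ ^ 2 ≤ ρ * (s * (T + noiseExcess s T V 0 E)) * ‖N‖ ^ 2 := by
  rcases Nat.eq_zero_or_pos ρ with rfl | h
  · have h1 := Submodule.finrank_eq_zero.1 (Nat.le_zero.1 hρ)
    have h2 : N = 0 := by
      refine PiLp.ext fun k => ?_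
      have : N k ∈ Submodule.span ℝ (Set.range fun k => N k) := Submodule.subset_span ⟨k, rfl⟩
      rw [h1] at this
      simpa using this
    simp [h2]
  · simpa using inner_add_sq_le_noiseExcess hs T (E := E) (K := 0) (by simp) hN hρ h

lemma finrank_span_map_sub_le {F' ι : Type*} [AddCommGroup F'] [Module ℝ F']
    (L : F →ₗ[ℝ] F') (x y : ι → F) :
    Module.finrank ℝ (Submodule.span ℝ (Set.range fun k => L (x k - y k))) ≤
      Module.finrank ℝ (Submodule.span ℝ (Set.range x)) +
        Module.finrank ℝ (Submodule.span ℝ (Set.range y)) := by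
  have h : Submodule.span ℝ (Set.range fun k => L (x k - y k)) ≤
      (Submodule.span ℝ (Set.range x) ⊔ Submodule.span ℝ (Set.range y)).map L := by
    rw [Submodule.span_le]
    rintro _ ⟨k, rfl⟩
    refine Submodule.mem_map_of_mem (Submodule.sub_mem _ ?_ ?_)
    · exact Submodule.mem_sup_left (Submodule.subset_span ⟨k, rfl⟩)
    · exact Submodule.mem_sup_right (Submodule.subset_span ⟨k, rfl⟩)
  exact (Submodule.finrank_mono h).trans ((Submodule.finrank_map_le _ _).trans
    (Submodule.finrank_add_le_finrank_add_finrank _ _))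

/-- The columns of `x` projected onto `V`. -/
noncomputable def projectColumns (V : Submodule ℝ F) (x : ColumnSpace F n) : ColumnSpace F n :=
  WithLp.toLp 2 fun k => V.starProjection (x k)

/-- Noise bound when the column space of the estimator is projected out. -/
lemma inner_sub_sq_le_of_mem_left {s : ℝ} (hs : 0 < s) (T : ℝ) {V : Submodule ℝ F}
    {E h b : ColumnSpace F n} {ρ : ℕ} (hh : ∀ k, h k ∈ V)
    (hρ : Module.finrank ℝ (Submodule.span ℝ (Set.range fun k => h k)) +
      Module.finrank ℝ (Submodule.span ℝ (Set.range fun k => b k)) ≤ ρ) (hρ1 : 1 ≤ ρ) :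
    ⟪E, h - b⟫ ^ 2 ≤
      ρ * (s * (T + noiseExcess s T V (-projectColumns Vᗮ b) E)) * ‖h - b‖ ^ 2 := by
  have hdec : h - b = projectColumns V (h - b) + -projectColumns Vᗮ b := by
    refine PiLp.ext fun k => ?_
    have h1 : V.starProjection (h k) = h k := Submodule.starProjection_eq_self_iff.2 (hh k)
    have h2 := V.starProjection_add_starProjection_orthogonal (b k)
    simp only [projectColumns, PiLp.sub_apply, PiLp.add_apply, PiLp.neg_apply, map_sub, h1]
    nth_rw 1 [← h2]
    abel
  conv_lhs => rw [hdec]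
  conv_rhs => rw [hdec]
  refine inner_add_sq_le_noiseExcess hs T (fun k => ?_) (fun k => ?_) ?_ hρ1
  · exact Submodule.neg_mem _ (Submodule.starProjection_apply_mem _ _)
  · exact Submodule.starProjection_apply_mem _ _
  · exact (finrank_span_map_sub_le (V.starProjection : F →ₗ[ℝ] F) (fun k => h k)
      (fun k => b k)).trans hρ

/-- Noise bound when the column space of the reference matrix is projected out. -/
lemma inner_sub_sq_le_of_mem_right {s : ℝ} (hs : 0 < s) {T T' : ℝ} (hT : 0 ≤ T) (hT' : 0 ≤ T')
    {V W : Submodule ℝ F} {E h b : ColumnSpace F n} {ρ ρ' : ℕ} (hh : ∀ k, h k ∈ W)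
    (hb : ∀ k, b k ∈ V)
    (hρ : Module.finrank ℝ (Submodule.span ℝ (Set.range fun k => h k)) ≤ ρ)
    (hρ' : Module.finrank ℝ (Submodule.span ℝ (Set.range fun k => b k)) ≤ ρ') :
    ⟪E, h - b⟫ ^ 2 ≤
      ((ρ + ρ' : ℕ) * (s * (T + noiseExcess s T V 0 E)) + ρ * (s * (T' +
        noiseExcess s T' (W.map (Vᗮ.starProjection : F →ₗ[ℝ] F)) 0 E))) * ‖h - b‖ ^ 2 := by
  have hdec : h - b = projectColumns V (h - b) + projectColumns Vᗮ h := by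
    refine PiLp.ext fun k => ?_
    have h1 : V.starProjection (b k) = b k := Submodule.starProjection_eq_self_iff.2 (hb k)
    have h2 := V.starProjection_add_starProjection_orthogonal (h k)
    simp only [projectColumns, PiLp.sub_apply, PiLp.add_apply, map_sub, h1]
    nth_rw 1 [← h2]
    abel
  have hi1 := inner_sq_le_noiseExcess hs T (E := E) (N := projectColumns V (h - b)) (V := V)
    (ρ := ρ + ρ') (fun k => Submodule.starProjection_apply_mem _ _)
    ((finrank_span_map_sub_le (V.starProjection : F →ₗ[ℝ] F) (fun k => h k)
      (fun k => b k)).trans (add_le_add hρ hρ'))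
  have hi2 := inner_sq_le_noiseExcess hs T' (E := E) (N := projectColumns Vᗮ h)
    (V := W.map (Vᗮ.starProjection : F →ₗ[ℝ] F))
    (ρ := ρ) (fun k => Submodule.mem_map_of_mem (hh k))
    ((finrank_span_map_le (Vᗮ.starProjection : F →ₗ[ℝ] F) (fun k => h k)).trans hρ)
  set D := ((ρ + ρ' : ℕ) : ℝ) * (s * (T + noiseExcess s T V 0 E))
  set D' := (ρ : ℝ) * (s * (T' + noiseExcess s T' (W.map (Vᗮ.starProjection : F →ₗ[ℝ] F)) 0 E))
  have hD : 0 ≤ D := by have := noiseExcess_nonneg s T V 0 E; positivity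
  have hD' : 0 ≤ D' := by
    have := noiseExcess_nonneg s T' (W.map (Vᗮ.starProjection : F →ₗ[ℝ] F)) 0 E
    positivity
  have horth : ⟪projectColumns V (h - b), projectColumns Vᗮ h⟫ = 0 := by
    rw [PiLp.inner_apply]
    exact Finset.sum_eq_zero fun k _ => Submodule.inner_right_of_mem_orthogonal
      (Submodule.starProjection_apply_mem _ _) (Submodule.starProjection_apply_mem Vᗮ _)
  rw [hdec, norm_add_sq_real, horth, inner_add_right, mul_zero, add_zero]
  generalize ⟪E, projectColumns V (h - b)⟫ = x at *
  generalize ⟪E, projectColumns Vᗮ h⟫ = y at *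
  generalize ‖projectColumns V (h - b)‖ = u at *
  generalize ‖projectColumns Vᗮ h‖ = v at *
  -- The two bounds combine by Cauchy-Schwarz with weights `D` and `D'`: `(x + y)² ≤ (D + D')(u² +
  -- v²)`.
  have hxy : (x * y) ^ 2 ≤ (D * u ^ 2) * (D' * v ^ 2) := by
    rw [mul_pow]
    exact mul_le_mul hi1 hi2 (sq_nonneg _) (by positivity)
  have hcross : 2 * (x * y) ≤ D * v ^ 2 + D' * u ^ 2 := by
    refine (abs_le_of_sq_le_sq' ?_ (by positivity)).2
    nlinarith [sq_nonneg (D * v ^ 2 - D' * u ^ 2)]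
  nlinarith

/-- Expanding the squares cancels `‖y‖²` and leaves `2⟪y, h - b⟫`. The parameter `c` weights AM-GM
on this term and `d` weights the split of `‖h - b‖²` through `x`; the result is useful when `(1 + d)
/ c < 1`. -/
lemma norm_sub_sq_le_of_basic_inequality {H : Type*} [NormedAddCommGroup H] [InnerProductSpace ℝ H]
    {x y h b : H} {P P' Γ c d : ℝ} (hc : 0 < c) (hd : 0 < d) (hΓ : 0 ≤ Γ)
    (hbasic : ‖x + y - h‖ ^ 2 + P ≤ ‖x + y - b‖ ^ 2 + P')
    (hin : ⟪y, h - b⟫ ^ 2 ≤ Γ * ‖h - b‖ ^ 2) :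
    ‖x - h‖ ^ 2 ≤ ‖x - b‖ ^ 2 + ((1 + d) * ‖x - h‖ ^ 2 + (1 + d⁻¹) * ‖x - b‖ ^ 2) / c + c * Γ +
      P' - P := by
  have h1 : ‖x + y - h‖ ^ 2 = ‖x - h‖ ^ 2 + 2 * ⟪y, x - h⟫ + ‖y‖ ^ 2 := by
    rw [show x + y - h = (x - h) + y by abel, norm_add_sq_real, real_inner_comm]
  have h2 : ‖x + y - b‖ ^ 2 = ‖x - b‖ ^ 2 + 2 * ⟪y, x - b⟫ + ‖y‖ ^ 2 := by
    rw [show x + y - b = (x - b) + y by abel, norm_add_sq_real, real_inner_comm]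
  have h3 : ⟪y, x - b⟫ - ⟪y, x - h⟫ = ⟪y, h - b⟫ := by
    rw [← inner_sub_right]
    congr 1
    abel
  have h4 : 2 * ⟪y, h - b⟫ ≤ ‖h - b‖ ^ 2 / c + c * Γ := by
    have h5 : (2 * ⟪y, h - b⟫) ^ 2 ≤ (‖h - b‖ ^ 2 / c + c * Γ) ^ 2 := by
      have h6 : ‖h - b‖ ^ 2 / c * (c * Γ) = Γ * ‖h - b‖ ^ 2 := by field_simp
      nlinarith [sq_nonneg (‖h - b‖ ^ 2 / c - c * Γ)]
    exact abs_le_of_sq_le_sq' h5 (by positivity) |>.2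
  have h7 : ‖h - b‖ ^ 2 ≤ (1 + d) * ‖x - h‖ ^ 2 + (1 + d⁻¹) * ‖x - b‖ ^ 2 := by
    have h8 : ‖h - b‖ ≤ ‖x - h‖ + ‖x - b‖ := by
      rw [show h - b = (x - b) - (x - h) by abel, add_comm]
      exact norm_sub_le _ _
    have h9 : ‖h - b‖ ^ 2 ≤ (‖x - h‖ + ‖x - b‖) ^ 2 := by gcongr
    have h10 : 2 * (‖x - h‖ * ‖x - b‖) ≤ d * ‖x - h‖ ^ 2 + d⁻¹ * ‖x - b‖ ^ 2 := by
      have h11 : d * d⁻¹ = 1 := mul_inv_cancel₀ hd.ne'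
      have h12 : 0 ≤ d⁻¹ * (d * ‖x - h‖ - ‖x - b‖) ^ 2 := by positivity
      have h13 : d⁻¹ * (d * ‖x - h‖ - ‖x - b‖) ^ 2 = (d * d⁻¹) * d * ‖x - h‖ ^ 2 -
        2 * (d * d⁻¹) * (‖x - h‖ * ‖x - b‖) + d⁻¹ * ‖x - b‖ ^ 2 := by ring
      rw [h13, h11] at h12
      linarith
    nlinarith
  have h14 : ‖h - b‖ ^ 2 / c ≤
      ((1 + d) * ‖x - h‖ ^ 2 + (1 + d⁻¹) * ‖x - b‖ ^ 2) / c := by gcongr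
  linarith

end Deterministic

/-! ### The pathwise oracle inequality -/

section Regression

variable {m n p : ℕ}

/-- The span of the columns of `X` with index in `J`. -/
noncomputable def columnSpan (X : Matrix (Fin m) (Fin p) ℝ) (J : Finset (Fin p)) :
    Submodule ℝ (EuclideanSpace ℝ (Fin m)) :=
  Submodule.span ℝ (J.image fun i => WithLp.toLp 2 fun l => X l i)

lemma finrank_columnSpan_le (X : Matrix (Fin m) (Fin p) ℝ) (J : Finset (Fin p)) :
    Module.finrank ℝ (columnSpan X J) ≤ J.card :=
  (finrank_span_finset_le_card _).trans Finset.card_image_le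

lemma toColumns_mul_mem (X : Matrix (Fin m) (Fin p) ℝ) (B : Matrix (Fin p) (Fin n) ℝ) (k : Fin n) :
    toColumns (X * B) k ∈ columnSpan X (rowSupport B) := by
  have h : toColumns (X * B) k =
      ∑ i ∈ rowSupport B, B i k • (WithLp.toLp 2 fun l => X l i : EuclideanSpace ℝ (Fin m)) := by
    ext l
    rw [toColumns_apply, Matrix.mul_apply]
    simp only [WithLp.ofLp_sum, WithLp.ofLp_smul, Finset.sum_apply, Pi.smul_apply, smul_eq_mul]
    symm
    simp_rw [mul_comm (B _ k)]
    refine Finset.sum_subset (Finset.subset_univ _) fun i _ hi => ?_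
    have : B i k = 0 := by
      by_contra hne
      exact hi (by simpa [rowSupport] using ⟨k, hne⟩)
    rw [this, mul_zero]
  rw [h]
  refine Submodule.sum_mem _ fun i hi => Submodule.smul_mem _ _ (Submodule.subset_span ?_)
  exact Finset.mem_coe.2 (Finset.mem_image_of_mem _ hi)

lemma finrank_span_toColumns_mul_le (X : Matrix (Fin m) (Fin p) ℝ) (B : Matrix (Fin p) (Fin n) ℝ) :
    Module.finrank ℝ (Submodule.span ℝ (Set.range fun k => toColumns (X * B) k)) ≤ B.rank := by
  refine le_trans ?_ (Matrix.rank_mul_le_right X B)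
  rw [Matrix.rank_eq_finrank_span_cols]
  exact finrank_span_map_le (WithLp.linearEquiv 2 ℝ (Fin m → ℝ)).symm.toLinearMap (X * B).col

lemma subsetComplexity_nonneg {j : ℕ} (h : j ≤ p) : 0 ≤ subsetComplexity p j := by
  have h1 : 0 ≤ Real.log (2 * Real.exp 1) :=
    Real.log_nonneg (by linarith [Real.exp_one_gt_d9])
  have h2 := le_mul_log_div h
  have h3 : (0 : ℝ) ≤ j := j.cast_nonneg
  unfold subsetComplexity
  nlinarith [mul_nonneg h1 h3]

lemma pen_eq (c σ : ℝ) (B : Matrix (Fin p) (Fin n) ℝ) :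
    pen c σ B = c * σ ^ 2 * B.rank * (2 * n + subsetComplexity p (rowSupport B).card) := by
  unfold pen subsetComplexity
  ring

lemma card_rowSupport_le (B : Matrix (Fin p) (Fin n) ℝ) : (rowSupport B).card ≤ p := by
  simpa using (rowSupport B).card_le_univ

/-- The level of the noise term attached to the subsets of size `j`. -/
noncomputable def noiseLevel (n p j : ℕ) : ℝ := 10 * n + 3 * subsetComplexity p j

lemma noiseLevel_nonneg (n : ℕ) {p j : ℕ} (h : j ≤ p) : 0 ≤ noiseLevel n p j := by
  have := subsetComplexity_nonneg h
  unfold noiseLevel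
  positivity

/-- Excess of the noise when the column space indexed by `J` is projected out of `X * B`. -/
noncomputable def estimatorExcess (s : ℝ) (X : Matrix (Fin m) (Fin p) ℝ)
    (B : Matrix (Fin p) (Fin n) ℝ) (E : Matrix (Fin m) (Fin n) ℝ) (J : Finset (Fin p)) : ℝ :=
  noiseExcess s (noiseLevel n p J.card) (columnSpan X J)
    (-projectColumns (columnSpan X J)ᗮ (toColumns (X * B))) (toColumns E)

/-- Excess of the noise on the column space of the reference matrix. -/
noncomputable def referenceExcess (s : ℝ) (X : Matrix (Fin m) (Fin p) ℝ)
    (B : Matrix (Fin p) (Fin n) ℝ) (E : Matrix (Fin m) (Fin n) ℝ) : ℝ :=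
  noiseExcess s (noiseLevel n p (rowSupport B).card) (columnSpan X (rowSupport B)) 0 (toColumns E)

/-- Excess of the noise on the part of the column space indexed by `J` that is orthogonal to the
column space of the reference matrix. -/
noncomputable def residualExcess (s : ℝ) (X : Matrix (Fin m) (Fin p) ℝ)
    (B : Matrix (Fin p) (Fin n) ℝ) (E : Matrix (Fin m) (Fin n) ℝ) (J : Finset (Fin p)) : ℝ :=
  noiseExcess s (noiseLevel n p J.card) ((columnSpan X J).map
    ((columnSpan X (rowSupport B))ᗮ.starProjection :
      EuclideanSpace ℝ (Fin m) →ₗ[ℝ] EuclideanSpace ℝ (Fin m))) 0 (toColumns E)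

/-- Oracle inequality before taking expectations. -/
lemma IsJRRS.frobSq_sub_le {σ : ℝ} (hσ : σ ≠ 0) {X : Matrix (Fin m) (Fin p) ℝ}
    {A B Bhat : Matrix (Fin p) (Fin n) ℝ} {E : Matrix (Fin m) (Fin n) ℝ}
    (hBhat : IsJRRS 12 σ X (X * A + E) Bhat) (hB : 1 ≤ B.rank) :
    frobSq (X * A - X * Bhat) ≤ 10 * frobSq (X * A - X * B) + 8 * pen 12 σ B +
      n * σ ^ 2 * (16 * estimatorExcess (σ ^ 2) X B E (rowSupport Bhat) +
        144 / 25 * (2 * referenceExcess (σ ^ 2) X B E +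
          residualExcess (σ ^ 2) X B E (rowSupport Bhat))) := by
  have hs : 0 < σ ^ 2 := by positivity
  have hbasic := hBhat B
  rw [← norm_sq_toColumns, ← norm_sq_toColumns, toColumns_sub, toColumns_sub] at hbasic
  have hadd : toColumns (X * A + E) = toColumns (X * A) + toColumns E := by
    ext k i
    simp [toColumns_apply]
  rw [hadd] at hbasic
  rw [← norm_sq_toColumns, ← norm_sq_toColumns, toColumns_sub, toColumns_sub]
  have hr : (Bhat.rank : ℝ) ≤ n := by exact_mod_cast Bhat.rank_le_width
  have hr' : (B.rank : ℝ) ≤ n := by exact_mod_cast B.rank_le_width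
  have hj := card_rowSupport_le Bhat
  have hj' := card_rowSupport_le B
  have hf := subsetComplexity_nonneg hj
  have hf' := subsetComplexity_nonneg hj'
  have hT := noiseLevel_nonneg n hj
  have hT' := noiseLevel_nonneg n hj'
  have hR1 : 0 ≤ estimatorExcess (σ ^ 2) X B E (rowSupport Bhat) := noiseExcess_nonneg _ _ _ _ _
  have hR0 : 0 ≤ referenceExcess (σ ^ 2) X B E := noiseExcess_nonneg _ _ _ _ _
  have hR2 : 0 ≤ residualExcess (σ ^ 2) X B E (rowSupport Bhat) := noiseExcess_nonneg _ _ _ _ _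
  have hn : (0 : ℝ) ≤ n := n.cast_nonneg
  have hrn : (0 : ℝ) ≤ Bhat.rank := Nat.cast_nonneg _
  have hrn' : (0 : ℝ) ≤ B.rank := Nat.cast_nonneg _
  rcases le_total B.rank Bhat.rank with hcase | hcase
  -- The estimator has the larger rank: projecting on its column space, the total rank `r + r' ≤ 2r`
  -- multiplies only the complexity of its own support, which its penalty absorbs.
  · have hin := inner_sub_sq_le_of_mem_left hs (noiseLevel n p (rowSupport Bhat).card)
      (E := toColumns E) (h := toColumns (X * Bhat)) (b := toColumns (X * B))
      (ρ := Bhat.rank + B.rank) (toColumns_mul_mem X Bhat)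
      (add_le_add (finrank_span_toColumns_mul_le X Bhat) (finrank_span_toColumns_mul_le X B))
      (by omega)
    rw [← estimatorExcess] at hin
    -- A quarter of the risk remains on the left; multiplying by `4` gives the factor `10` and the
    -- noise factor `8`.
    have hmain := norm_sub_sq_le_of_basic_inequality (c := 2) (d := 1 / 2) (by norm_num)
      (by norm_num) (by positivity) hbasic hin
    rw [pen_eq, pen_eq] at hmain
    rw [pen_eq]
    have hcase' : (B.rank : ℝ) ≤ Bhat.rank := by exact_mod_cast hcase
    simp only [noiseLevel] at hmain
    push_cast at hmain
    generalize subsetComplexity p (rowSupport Bhat).card = f at *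
    generalize subsetComplexity p (rowSupport B).card = f' at *
    generalize estimatorExcess (σ ^ 2) X B E (rowSupport Bhat) = R at *
    generalize (Bhat.rank : ℝ) = r at *
    generalize (B.rank : ℝ) = r' at *
    generalize (n : ℝ) = N at *
    have h1 : 8 * ((r + r') * (10 * N + 3 * f + R)) ≤
        48 * (r' * (2 * N + f')) + 48 * (r * (2 * N + f)) + 16 * (N * R) := by
      linarith [mul_nonneg hrn hn, mul_nonneg hrn' hn, mul_nonneg hrn' hf',
        mul_nonneg (sub_nonneg.2 hcase') hf, mul_nonneg (sub_nonneg.2 hr) hR1,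
        mul_nonneg (sub_nonneg.2 hr') hR1]
    have h2 := mul_le_mul_of_nonneg_left h1 hs.le
    have h3 : 0 ≤ N * σ ^ 2 * (2 * referenceExcess (σ ^ 2) X B E +
      residualExcess (σ ^ 2) X B E (rowSupport Bhat)) := by positivity
    norm_num at hmain
    linarith
  -- The reference has the larger rank: `r + r' ≤ 2r'` multiplies the reference complexity, and the
  -- part orthogonal to its column space has rank at most `r`, so the estimator's complexity is
  -- multiplied by `r` alone.
  · have hin := inner_sub_sq_le_of_mem_right hs hT' hT
      (E := toColumns E) (h := toColumns (X * Bhat)) (b := toColumns (X * B))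
      (ρ := Bhat.rank) (ρ' := B.rank) (toColumns_mul_mem X Bhat) (toColumns_mul_mem X B)
      (finrank_span_toColumns_mul_le X Bhat) (finrank_span_toColumns_mul_le X B)
    rw [← referenceExcess, ← residualExcess] at hin
    -- Here `5/12` of the risk remains; multiplying by `12/5` gives the factor `59/10 ≤ 10` and the
    -- noise factor `144/25`.
    have hmain := norm_sub_sq_le_of_basic_inequality (c := 12 / 5) (d := 2 / 5) (by norm_num)
      (by norm_num) (by positivity) hbasic hin
    rw [pen_eq, pen_eq] at hmain
    rw [pen_eq]
    have hcase' : (Bhat.rank : ℝ) ≤ B.rank := by exact_mod_cast hcase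
    simp only [noiseLevel] at hmain
    push_cast at hmain
    have hF0 := sq_nonneg ‖toColumns (X * A) - toColumns (X * B)‖
    generalize subsetComplexity p (rowSupport Bhat).card = f at *
    generalize subsetComplexity p (rowSupport B).card = f' at *
    generalize referenceExcess (σ ^ 2) X B E = R at *
    generalize residualExcess (σ ^ 2) X B E (rowSupport Bhat) = R' at *
    generalize (Bhat.rank : ℝ) = r at *
    generalize (B.rank : ℝ) = r' at *
    generalize (n : ℝ) = N at *
    have h1 : 144 / 25 * ((r + r') * (10 * N + 3 * f' + R) + r * (10 * N + 3 * f + R')) ≤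
        336 / 5 * (r' * (2 * N + f')) + 144 / 5 * (r * (2 * N + f)) +
          144 / 25 * (N * (2 * R + R')) := by
      linarith [mul_nonneg hrn hn, mul_nonneg hrn' hn, mul_nonneg hrn' hf', mul_nonneg hrn hf,
        mul_nonneg (sub_nonneg.2 hcase') hf', mul_nonneg (sub_nonneg.2 hr) hR0,
        mul_nonneg (sub_nonneg.2 hcase') hn,
        mul_nonneg (sub_nonneg.2 hr') hR0, mul_nonneg (sub_nonneg.2 hr) hR2]
    have h2 := mul_le_mul_of_nonneg_left h1 hs.le
    have h3 : 0 ≤ N * σ ^ 2 * estimatorExcess (σ ^ 2) X B E (rowSupport Bhat) := by positivity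
    norm_num at hmain
    linarith

end Regression

/-! ### Taking expectations -/

section Expectation

variable {Ω : Type*} [MeasurableSpace Ω] {μ : Measure Ω} {m n p : ℕ}

lemma frobSq_nonneg (M : Matrix (Fin m) (Fin n) ℝ) : 0 ≤ frobSq M := by
  unfold frobSq
  positivity

/-- The total excess of the noise over its level. -/
noncomputable def totalExcess (s : ℝ) (X : Matrix (Fin m) (Fin p) ℝ)
    (B : Matrix (Fin p) (Fin n) ℝ) (E : Matrix (Fin m) (Fin n) ℝ) : ℝ :=
  16 * ∑ J, estimatorExcess s X B E J +
    144 / 25 * (2 * referenceExcess s X B E + ∑ J, residualExcess s X B E J)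

/-- The sums over supports converge geometrically to at most `5/2`, so the constant is `432/49 · (16
· 5/2 + 144/25 · (2 + 5/2))`, about `581`. -/
lemma integral_totalExcess_le [SFinite μ] {σ : ℝ≥0} (hσ : σ ≠ 0)
    {E : Ω → Matrix (Fin m) (Fin n) ℝ} (hE : IsGaussianNoise σ E μ)
    (X : Matrix (Fin m) (Fin p) ℝ) (B : Matrix (Fin p) (Fin n) ℝ) :
    Integrable (fun ω => totalExcess ((σ : ℝ) ^ 2) X B (E ω)) μ ∧
      ∫ ω, totalExcess ((σ : ℝ) ^ 2) X B (E ω) ∂μ ≤ 768 * Real.exp (-(n : ℝ) / 2) := by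
  have hs : (0 : ℝ) < (σ : ℝ) ^ 2 := by positivity
  have hEm : AEMeasurable (fun ω => toColumns (E ω)) μ :=
    aemeasurable_toColumns fun i j => (hE.law i j).aemeasurable
  set w : ℕ → ℝ := fun j => (3 / 5 : ℝ) ^ j *
    Real.exp (-(j * Real.log (Real.exp 1 * (p : ℝ) / (j : ℝ)))) with hw
  have hbound : ∀ (J : Finset (Fin p)) (V : Submodule ℝ (EuclideanSpace ℝ (Fin m)))
      (K : ColumnSpace (EuclideanSpace ℝ (Fin m)) n), Module.finrank ℝ V ≤ J.card →
      Integrable (fun ω => noiseExcess ((σ : ℝ) ^ 2) (noiseLevel n p J.card) V K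
        (toColumns (E ω))) μ ∧
      ∫ ω, noiseExcess ((σ : ℝ) ^ 2) (noiseLevel n p J.card) V K (toColumns (E ω)) ∂μ ≤
        432 / 49 * Real.exp (-(n : ℝ) / 2) * w J.card := by
    intro J V K hV
    obtain ⟨h1, h2⟩ := integrable_noiseExcess hs hEm hE.lintegral_exp_inner_le
      (noiseLevel n p J.card) V K hV
    have h3 := exp_neg_mul_pow_le n (show J.card ≤ p by simpa using J.card_le_univ)
    refine ⟨h1, h2.trans ?_⟩
    unfold noiseLevel
    rw [mul_assoc]
    calc _ ≤ 144 / 49 * _ := mul_le_mul_of_nonneg_left h3 (by norm_num)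
      _ = _ := by ring
  have h1 := fun J => hbound J (columnSpan X J)
    (-projectColumns (columnSpan X J)ᗮ (toColumns (X * B))) (finrank_columnSpan_le X J)
  have h0 := hbound (rowSupport B) (columnSpan X (rowSupport B)) 0 (finrank_columnSpan_le X _)
  have h2 := fun J => hbound J ((columnSpan X J).map
    ((columnSpan X (rowSupport B))ᗮ.starProjection :
      EuclideanSpace ℝ (Fin m) →ₗ[ℝ] EuclideanSpace ℝ (Fin m))) 0
    ((Submodule.finrank_map_le _ _).trans (finrank_columnSpan_le X J))
  have hsum : ∑ J : Finset (Fin p), 432 / 49 * Real.exp (-(n : ℝ) / 2) * w J.card ≤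
      432 / 49 * Real.exp (-(n : ℝ) / 2) * (5 / 2) := by
    rw [← Finset.mul_sum]
    gcongr
    exact sum_finset_exp_neg_le p
  have hw1 : w (rowSupport B).card ≤ 1 := by
    refine mul_le_one₀ (pow_le_one₀ (by norm_num) (by norm_num)) (Real.exp_pos _).le ?_
    rw [Real.exp_le_one_iff]
    have := le_mul_log_div (card_rowSupport_le B)
    have : (0 : ℝ) ≤ (rowSupport B).card := Nat.cast_nonneg _
    linarith
  have i1 : Integrable (fun ω => ∑ J, estimatorExcess ((σ : ℝ) ^ 2) X B (E ω) J) μ :=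
    integrable_finsetSum _ fun J _ => (h1 J).1
  have i0 : Integrable (fun ω => referenceExcess ((σ : ℝ) ^ 2) X B (E ω)) μ := h0.1
  have i2 : Integrable (fun ω => ∑ J, residualExcess ((σ : ℝ) ^ 2) X B (E ω) J) μ :=
    integrable_finsetSum _ fun J _ => (h2 J).1
  have e1 : ∫ ω, ∑ J, estimatorExcess ((σ : ℝ) ^ 2) X B (E ω) J ∂μ ≤
      432 / 49 * Real.exp (-(n : ℝ) / 2) * (5 / 2) := by
    rw [integral_finsetSum (f := fun J ω => estimatorExcess ((σ : ℝ) ^ 2) X B (E ω) J) _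
      fun J _ => (h1 J).1]
    exact (Finset.sum_le_sum fun J _ => (h1 J).2).trans hsum
  have e0 : ∫ ω, referenceExcess ((σ : ℝ) ^ 2) X B (E ω) ∂μ ≤
      432 / 49 * Real.exp (-(n : ℝ) / 2) :=
    h0.2.trans (mul_le_of_le_one_right (by positivity) hw1)
  have e2 : ∫ ω, ∑ J, residualExcess ((σ : ℝ) ^ 2) X B (E ω) J ∂μ ≤
      432 / 49 * Real.exp (-(n : ℝ) / 2) * (5 / 2) := by
    rw [integral_finsetSum (f := fun J ω => residualExcess ((σ : ℝ) ^ 2) X B (E ω) J) _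
      fun J _ => (h2 J).1]
    exact (Finset.sum_le_sum fun J _ => (h2 J).2).trans hsum
  have i02 : Integrable (fun ω => 2 * referenceExcess ((σ : ℝ) ^ 2) X B (E ω) +
      ∑ J, residualExcess ((σ : ℝ) ^ 2) X B (E ω) J) μ := (i0.const_mul _).add i2
  unfold totalExcess
  refine ⟨(i1.const_mul _).add (i02.const_mul _), ?_⟩
  rw [integral_add (i1.const_mul _) (i02.const_mul _), integral_const_mul,
    integral_const_mul, integral_add (i0.const_mul _) i2, integral_const_mul]
  have := Real.exp_pos (-(n : ℝ) / 2)
  linarith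

/-- Bounding the excess at the random support by the sum over all supports makes the remainder a
function of the noise alone. -/
lemma IsJRRS.frobSq_sub_le_totalExcess {σ : ℝ} (hσ : σ ≠ 0) {X : Matrix (Fin m) (Fin p) ℝ}
    {A B Bhat : Matrix (Fin p) (Fin n) ℝ} {E : Matrix (Fin m) (Fin n) ℝ}
    (hBhat : IsJRRS 12 σ X (X * A + E) Bhat) (hB : 1 ≤ B.rank) :
    frobSq (X * A - X * Bhat) ≤ 10 * frobSq (X * A - X * B) + 8 * pen 12 σ B +
      n * σ ^ 2 * totalExcess (σ ^ 2) X B E := by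
  refine (hBhat.frobSq_sub_le hσ hB).trans ?_
  unfold totalExcess
  gcongr
  · exact Finset.single_le_sum (f := fun J => estimatorExcess (σ ^ 2) X B E J)
      (fun J _ => noiseExcess_nonneg _ _ _ _ _) (Finset.mem_univ _)
  · exact Finset.single_le_sum (f := fun J => residualExcess (σ ^ 2) X B E J)
      (fun J _ => noiseExcess_nonneg _ _ _ _ _) (Finset.mem_univ _)

lemma pen_nonneg (σ : ℝ) (B : Matrix (Fin p) (Fin n) ℝ) : 0 ≤ pen 12 σ B := by
  have := subsetComplexity_nonneg (card_rowSupport_le B)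
  rw [pen_eq]
  positivity

/-- In the noiseless case the estimator reproduces the signal. -/
lemma IsJRRS.frobSq_sub_eq_zero {X : Matrix (Fin m) (Fin p) ℝ} {A Bhat : Matrix (Fin p) (Fin n) ℝ}
    (hBhat : IsJRRS 12 0 X (X * A) Bhat) : frobSq (X * A - X * Bhat) = 0 := by
  refine le_antisymm ?_ (frobSq_nonneg _)
  have h := hBhat A
  simpa [pen, frobSq] using h

lemma IsGaussianNoise.ae_eq_zero {E : Ω → Matrix (Fin m) (Fin n) ℝ} (hE : IsGaussianNoise 0 E μ) :
    ∀ᵐ ω ∂μ, E ω = 0 := by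
  have h : ∀ i j, ∀ᵐ ω ∂μ, E ω i j = 0 := by
    intro i j
    have hlaw := (hE.law i j).map_eq
    rw [zero_pow two_ne_zero, gaussianReal_zero_var] at hlaw
    refine ae_of_ae_map (p := fun x => x = 0) (hE.law i j).aemeasurable ?_
    rw [hlaw, ae_dirac_eq]
    exact Filter.eventually_pure.2 rfl
  filter_upwards [ae_all_iff.2 fun i => ae_all_iff.2 (h i)] with ω hω
  ext i j
  exact hω i j

lemma aestronglyMeasurable_frobSq_sub (X : Matrix (Fin m) (Fin p) ℝ)
    (A : Matrix (Fin p) (Fin n) ℝ) {Bhat : Ω → Matrix (Fin p) (Fin n) ℝ}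
    (hm : ∀ i j, AEMeasurable (fun ω => Bhat ω i j) μ) :
    AEStronglyMeasurable (fun ω => frobSq (X * A - X * Bhat ω)) μ := by
  refine AEMeasurable.aestronglyMeasurable ?_
  simp only [frobSq, Matrix.sub_apply, Matrix.mul_apply]
  refine Finset.aemeasurable_fun_sum _ fun i _ => Finset.aemeasurable_fun_sum _ fun j _ => ?_
  refine AEMeasurable.pow_const (aemeasurable_const.sub ?_) 2
  exact Finset.aemeasurable_fun_sum _ fun k _ => (hm k j).const_mul _

/-- Oracle inequality in expectation. -/
lemma integral_frobSq_sub_le [IsProbabilityMeasure μ] {σ : ℝ≥0} {X : Matrix (Fin m) (Fin p) ℝ}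
    {A : Matrix (Fin p) (Fin n) ℝ} {E Y : Ω → Matrix (Fin m) (Fin n) ℝ}
    {Bhat : Ω → Matrix (Fin p) (Fin n) ℝ} (hE : IsGaussianNoise σ E μ)
    (hY : ∀ ω, Y ω = X * A + E ω) (hm : ∀ i j, AEMeasurable (fun ω => Bhat ω i j) μ)
    (hBhat : ∀ᵐ ω ∂μ, IsJRRS 12 σ X (Y ω) (Bhat ω)) {B : Matrix (Fin p) (Fin n) ℝ}
    (hB : 1 ≤ B.rank) :
    Integrable (fun ω => frobSq (X * A - X * Bhat ω)) μ ∧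
      ∫ ω, frobSq (X * A - X * Bhat ω) ∂μ ≤
        10 * frobSq (X * A - X * B) + 8 * pen 12 σ B +
          768 * (n : ℝ) * (σ : ℝ) ^ 2 * Real.exp (-(n : ℝ) / 2) := by
  have hpen := pen_nonneg (σ : ℝ) B
  have hfrob := frobSq_nonneg (X * A - X * B)
  -- The excess divides by `σ²`, so the noiseless case is separate.
  rcases eq_or_ne σ 0 with rfl | hσ
  · have hzero : (fun ω => frobSq (X * A - X * Bhat ω)) =ᵐ[μ] fun _ => 0 := by
      filter_upwards [hE.ae_eq_zero, hBhat] with ω hω hω'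
      rw [hY, hω, add_zero] at hω'
      exact hω'.frobSq_sub_eq_zero
    refine ⟨(integrable_zero _ _ _).congr hzero.symm, ?_⟩
    rw [integral_congr_ae hzero, integral_zero]
    positivity
  obtain ⟨hint, hle⟩ := integral_totalExcess_le hσ hE X B
  have hdom : ∀ᵐ ω ∂μ, frobSq (X * A - X * Bhat ω) ≤
      10 * frobSq (X * A - X * B) + 8 * pen 12 σ B +
        n * (σ : ℝ) ^ 2 * totalExcess ((σ : ℝ) ^ 2) X B (E ω) := by
    filter_upwards [hBhat] with ω hω
    rw [hY] at hω
    exact hω.frobSq_sub_le_totalExcess (by exact_mod_cast hσ) hB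
  have hint' : Integrable (fun ω => 10 * frobSq (X * A - X * B) + 8 * pen 12 σ B +
      n * (σ : ℝ) ^ 2 * totalExcess ((σ : ℝ) ^ 2) X B (E ω)) μ :=
    (integrable_const _).add (hint.const_mul _)
  have hF : Integrable (fun ω => frobSq (X * A - X * Bhat ω)) μ := by
    refine hint'.mono' (aestronglyMeasurable_frobSq_sub X A hm) ?_
    filter_upwards [hdom] with ω hω
    rwa [Real.norm_of_nonneg (frobSq_nonneg _)]
  refine ⟨hF, (integral_mono_ae hF hint' hdom).trans ?_⟩
  rw [integral_add (integrable_const _) (hint.const_mul _), integral_const_mul]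
  simp only [integral_const, probReal_univ, one_smul]
  have h := mul_le_mul_of_nonneg_left hle (show 0 ≤ (n : ℝ) * (σ : ℝ) ^ 2 by positivity)
  linarith

lemma integrable_frobSq_sub [IsProbabilityMeasure μ] {σ : ℝ≥0} {X : Matrix (Fin m) (Fin p) ℝ}
    {A : Matrix (Fin p) (Fin n) ℝ} {E Y : Ω → Matrix (Fin m) (Fin n) ℝ}
    {Bhat : Ω → Matrix (Fin p) (Fin n) ℝ} (hE : IsGaussianNoise σ E μ)
    (hY : ∀ ω, Y ω = X * A + E ω) (hm : ∀ i j, AEMeasurable (fun ω => Bhat ω i j) μ)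
    (hBhat : ∀ᵐ ω ∂μ, IsJRRS 12 σ X (Y ω) (Bhat ω)) :
    Integrable (fun ω => frobSq (X * A - X * Bhat ω)) μ := by
  by_cases h : ∃ B : Matrix (Fin p) (Fin n) ℝ, 1 ≤ B.rank
  · obtain ⟨B, hB⟩ := h
    exact (integral_frobSq_sub_le hE hY hm hBhat hB).1
  -- Without any matrix of positive rank the oracle inequality has no reference, but then the loss
  -- vanishes identically.
  · have hzero : ∀ B : Matrix (Fin p) (Fin n) ℝ, B = 0 := by
      intro B
      have hr : B.rank = 0 := by
        by_contra hne
        exact h ⟨B, Nat.one_le_iff_ne_zero.2 hne⟩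
      rw [Matrix.rank_eq_finrank_span_cols, Submodule.finrank_eq_zero, Submodule.span_eq_bot] at hr
      ext i j
      exact congrFun (hr _ ⟨j, rfl⟩) i
    have : ∀ ω, frobSq (X * A - X * Bhat ω) = 0 := by
      intro ω
      rw [hzero A, hzero (Bhat ω)]
      simp [frobSq]
    simp [this]

end Expectation

/-! ### Explicit rates -/

section Rates

variable {n p : ℕ}

/-- Positive rank absorbs the exponential remainder: `960 = 8 · 12 · 2 + 768`. Since `log (2e) ≤ 2`
and `j ≤ j log (ep/j)`, the complexity is at most three times its logarithmic part, so `288 = 8 · 12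
· 3`. -/
lemma oracle_bound_le (σ : ℝ) {A : Matrix (Fin p) (Fin n) ℝ} (hA : 1 ≤ A.rank) :
    8 * pen 12 σ A + 768 * (n : ℝ) * σ ^ 2 * Real.exp (-(n : ℝ) / 2) ≤
      σ ^ 2 * A.rank * (960 * n + 288 * ((rowSupport A).card *
        Real.log (Real.exp 1 * (p : ℝ) / ((rowSupport A).card : ℝ)))) := by
  have hA' : (1 : ℝ) ≤ A.rank := by exact_mod_cast hA
  have hL := le_mul_log_div (card_rowSupport_le A)
  have hlog : Real.log (2 * Real.exp 1) ≤ 2 := by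
    rw [Real.log_mul (by norm_num) (Real.exp_pos 1).ne', Real.log_exp]
    linarith [Real.log_two_lt_d9]
  have hj : (0 : ℝ) ≤ (rowSupport A).card := Nat.cast_nonneg _
  have hf : subsetComplexity p (rowSupport A).card ≤ 3 * ((rowSupport A).card *
      Real.log (Real.exp 1 * (p : ℝ) / ((rowSupport A).card : ℝ))) := by
    unfold subsetComplexity
    nlinarith
  have hexp : Real.exp (-(n : ℝ) / 2) ≤ A.rank := by
    refine le_trans ?_ hA'
    rw [Real.exp_le_one_iff]
    have : (0 : ℝ) ≤ n := n.cast_nonneg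
    linarith
  rw [pen_eq]
  set L := (rowSupport A).card * Real.log (Real.exp 1 * (p : ℝ) / ((rowSupport A).card : ℝ))
  calc _ ≤ 8 * (12 * σ ^ 2 * A.rank * (2 * n + 3 * L)) + 768 * (n : ℝ) * σ ^ 2 * A.rank := by
        gcongr
    _ = _ := by ring

/-- The factor `e` costs an extra `j`. It is at most `(3/2) j log (p/j)` when `2j ≤ p`, because `log
2 > 2/3`, and at most `n` otherwise. -/
lemma card_mul_log_le {j : ℕ} (hjp : j ≤ p) (h : 2 * j ≤ p ∨ j ≤ n) :
    (j : ℝ) * Real.log (Real.exp 1 * (p : ℝ) / (j : ℝ)) ≤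
      n + 5 / 2 * (j * Real.log ((p : ℝ) / (j : ℝ))) := by
  rcases Nat.eq_zero_or_pos j with rfl | hj
  · simp
  have hj' : (0 : ℝ) < j := by exact_mod_cast hj
  have hp' : (0 : ℝ) < p := by exact_mod_cast hj.trans_le hjp
  have h1 : Real.log (Real.exp 1 * (p : ℝ) / (j : ℝ)) = 1 + Real.log ((p : ℝ) / (j : ℝ)) := by
    rw [mul_div_assoc, Real.log_mul (Real.exp_pos 1).ne' (by positivity), Real.log_exp]
  have h2 : 0 ≤ Real.log ((p : ℝ) / (j : ℝ)) := by
    refine Real.log_nonneg ?_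
    rw [one_le_div hj']
    exact_mod_cast hjp
  rw [h1]
  rcases h with h | h
  · have h3 : Real.log 2 ≤ Real.log ((p : ℝ) / (j : ℝ)) := by
      refine Real.log_le_log (by norm_num) ?_
      rw [le_div_iff₀ hj']
      exact_mod_cast h
    have h4 := Real.log_two_gt_d9
    have : (0 : ℝ) ≤ n := n.cast_nonneg
    nlinarith
  · have : (j : ℝ) ≤ n := by exact_mod_cast h
    nlinarith [mul_nonneg hj'.le h2]

end Rates

theorem theorem1 :
    ∃ C : ℝ, 0 < C ∧
      ∀ {Ω : Type*} [MeasurableSpace Ω] (μ : Measure Ω) [IsProbabilityMeasure μ]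
        (m n p : ℕ) (σ : ℝ≥0)
        (X : Matrix (Fin m) (Fin p) ℝ) (A : Matrix (Fin p) (Fin n) ℝ)
        (E Y : Ω → Matrix (Fin m) (Fin n) ℝ) (Bhat : Ω → Matrix (Fin p) (Fin n) ℝ),
        IsGaussianNoise σ E μ →
        (∀ ω, Y ω = X * A + E ω) →
        (∀ i j, AEMeasurable (fun ω => Bhat ω i j) μ) →
        (∀ᵐ ω ∂μ, IsJRRS 12 σ X (Y ω) (Bhat ω)) →
        Integrable (fun ω => frobSq (X * A - X * Bhat ω)) μ ∧
        (∀ B : Matrix (Fin p) (Fin n) ℝ, 1 ≤ B.rank →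
          ∫ ω, frobSq (X * A - X * Bhat ω) ∂μ ≤
            10 * frobSq (X * A - X * B) + 8 * pen 12 σ B +
              768 * (n : ℝ) * (σ : ℝ) ^ 2 * Real.exp (-(n : ℝ) / 2)) ∧
        (1 ≤ A.rank →
          ∫ ω, frobSq (X * A - X * Bhat ω) ∂μ ≤
            C * ((σ : ℝ) ^ 2 * (A.rank : ℝ) *
              ((n : ℝ) + ((rowSupport A).card : ℝ) *
                Real.log (Real.exp 1 * (p : ℝ) / ((rowSupport A).card : ℝ))))) ∧
        (1 ≤ A.rank → (2 * (rowSupport A).card ≤ p ∨ (rowSupport A).card ≤ n) →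
          ∫ ω, frobSq (X * A - X * Bhat ω) ∂μ ≤
            C * ((σ : ℝ) ^ 2 * (A.rank : ℝ) *
              ((n : ℝ) + ((rowSupport A).card : ℝ) *
                Real.log ((p : ℝ) / ((rowSupport A).card : ℝ))))) := by
  -- A round value: the last bound needs only `960 + 288 = 1248` for `n` and `288 · 5/2 = 720` for
  -- the logarithmic term.
  refine ⟨2000, by norm_num, ?_⟩
  intro Ω _ μ _ m n p σ X A E Y Bhat hE hY hm hBhat
  have horacle : 1 ≤ A.rank → ∫ ω, frobSq (X * A - X * Bhat ω) ∂μ ≤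
      (σ : ℝ) ^ 2 * A.rank * (960 * n + 288 * ((rowSupport A).card *
        Real.log (Real.exp 1 * (p : ℝ) / ((rowSupport A).card : ℝ)))) := by
    intro hA
    have h := (integral_frobSq_sub_le hE hY hm hBhat hA).2
    rw [sub_self, show frobSq (0 : Matrix (Fin m) (Fin n) ℝ) = 0 by simp [frobSq], mul_zero,
      zero_add] at h
    exact h.trans (oracle_bound_le (σ : ℝ) hA)
  have hn : (0 : ℝ) ≤ n := n.cast_nonneg
  have hj : (0 : ℝ) ≤ (rowSupport A).card := Nat.cast_nonneg _
  refine ⟨integrable_frobSq_sub hE hY hm hBhat,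
    fun B hB => (integral_frobSq_sub_le hE hY hm hBhat hB).2, fun hA => ?_, fun hA h => ?_⟩
  · refine (horacle hA).trans ?_
    have hL := le_mul_log_div (card_rowSupport_le A)
    rw [mul_left_comm (2000 : ℝ)]
    refine mul_le_mul_of_nonneg_left ?_ (by positivity)
    linarith
  · refine (horacle hA).trans ?_
    have hL := card_mul_log_le (n := n) (card_rowSupport_le A) h
    have hL' := le_mul_log_div (card_rowSupport_le A)
    rw [mul_left_comm (2000 : ℝ)]
    refine mul_le_mul_of_nonneg_left ?_ (by positivity)
    linarith
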